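/- Let $S_1,\dots,S_r$ be elements of the $n$-qubit Pauli group (not necessarily independent) that generate an abelian group $\mathcal S$ not containing $-I$, and suppose that each $S_i$ has weight at most $3$, i.e. acts nontrivially on at most $3$ qubits. Consider the stabilizer code with checks $S_1,\dots,S_r$. Let $k=n-\operatorname{rank}\mathcal S$ be its dimension (number of logical qubits), and let $d$ be its distance, i.e. the smallest weight of a nontrivial logical operator: a Pauli operator that commutes with every element of $\mathcal S$ and is not, up to phase, an element of $\mathcal S$. Then $d\le 2$ or $k=0$. -/

import Mathlib

/-- An element of the `n`-qubit Pauli group, written uniquely as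
`i ^ phase • ⨂ j, X ^ (x j) * Z ^ (z j)`. In particular `X`, `Z`, `Y = i X Z` on one qubit are
`(x, z) = (1, 0), (0, 1), (1, 1)` with phases `0, 0, 1`. -/
@[ext]
structure PauliGroup (n : ℕ) where
  /-- the exponent of the scalar `i` -/
  phase : ZMod 4
  /-- the exponents of the `X` factors -/
  x : Fin n → ZMod 2
  /-- the exponents of the `Z` factors -/
  z : Fin n → ZMod 2

namespace PauliGroup

variable {n : ℕ}

/-- The exponent of `i` in the sign `(-1) ^ a`, for a bit `a`. -/
def signPhase (a : ZMod 2) : ZMod 4 := 2 * (a.val : ZMod 4)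

theorem signPhase_zero : signPhase 0 = 0 := by decide

theorem signPhase_add (a b : ZMod 2) : signPhase (a + b) = signPhase a + signPhase b := by
  revert a b; decide

theorem signPhase_neg (a : ZMod 2) : signPhase a + signPhase a = 0 := by
  revert a; decide

/-- Multiplication of Pauli operators: moving `Z ^ a` past `X ^ b` costs the sign `(-1) ^ (a b)`. -/
instance : Mul (PauliGroup n) :=
  ⟨fun P Q => ⟨P.phase + Q.phase + signPhase (P.z ⬝ᵥ Q.x), P.x + Q.x, P.z + Q.z⟩⟩

instance : One (PauliGroup n) := ⟨⟨0, 0, 0⟩⟩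

instance : Inv (PauliGroup n) := ⟨fun P => ⟨-P.phase - signPhase (P.z ⬝ᵥ P.x), P.x, P.z⟩⟩

theorem mul_def (P Q : PauliGroup n) :
    P * Q = ⟨P.phase + Q.phase + signPhase (P.z ⬝ᵥ Q.x), P.x + Q.x, P.z + Q.z⟩ := rfl

theorem one_def : (1 : PauliGroup n) = ⟨0, 0, 0⟩ := rfl

theorem inv_def (P : PauliGroup n) :
    P⁻¹ = ⟨-P.phase - signPhase (P.z ⬝ᵥ P.x), P.x, P.z⟩ := rfl

instance : Group (PauliGroup n) :=
  Group.ofLeftAxioms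
    (by
      intro P Q R
      simp only [mul_def, add_dotProduct, dotProduct_add, signPhase_add, PauliGroup.mk.injEq]
      exact ⟨by ring, add_assoc _ _ _, add_assoc _ _ _⟩)
    (by
      intro P
      simp [mul_def, one_def, signPhase_zero])
    (by
      intro P
      simp only [mul_def, one_def, inv_def, PauliGroup.mk.injEq]
      exact ⟨by ring, funext fun _ => CharTwo.add_self_eq_zero _,
        funext fun _ => CharTwo.add_self_eq_zero _⟩)

instance : Finite (PauliGroup n) :=
  Finite.of_injective
    (fun P : PauliGroup n => ((P.phase, P.x, P.z) : ZMod 4 × (Fin n → ZMod 2) × (Fin n → ZMod 2)))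
    (by
      intro P Q h
      simp only [Prod.mk.injEq] at h
      exact PauliGroup.ext h.1 h.2.1 h.2.2)

/-- The scalar operator `i ^ c • I`. -/
def scalar (c : ZMod 4) : PauliGroup n := ⟨c, 0, 0⟩

/-- The operator `-I`. -/
def negI : PauliGroup n := scalar 2

/-- The support of a Pauli operator: the qubits on which it acts as `X`, `Y` or `Z`. -/
def support (P : PauliGroup n) : Finset (Fin n) :=
  Finset.univ.filter fun j => P.x j ≠ 0 ∨ P.z j ≠ 0

/-- The weight of a Pauli operator: the size of its support. -/
def weight (P : PauliGroup n) : ℕ := P.support.card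

/-- The `2 × 2` matrix `X ^ a * Z ^ b`, for bits `a` and `b`. -/
noncomputable def qubitMatrix (a b : ZMod 2) : Matrix (Fin 2) (Fin 2) ℂ :=
  !![0, 1; 1, 0] ^ a.val * !![1, 0; 0, -1] ^ b.val

/-- The operator on `n` qubits, `i ^ phase` times the Kronecker product of the single-qubit factors,
as a matrix in the computational basis. -/
noncomputable def toMatrix (P : PauliGroup n) : Matrix (Fin n → Fin 2) (Fin n → Fin 2) ℂ :=
  Complex.I ^ P.phase.val • Matrix.of fun s t => ∏ j, qubitMatrix (P.x j) (P.z j) (s j) (t j)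

theorem I_pow_add (a b : ZMod 4) :
    Complex.I ^ (a + b).val = Complex.I ^ a.val * Complex.I ^ b.val := by
  rw [← pow_add, ZMod.val_add, ← Complex.I_pow_eq_pow_mod]

theorem I_pow_signPhase_sum {ι : Type*} (s : Finset ι) (f : ι → ZMod 2) :
    Complex.I ^ (signPhase (∑ j ∈ s, f j)).val = ∏ j ∈ s, Complex.I ^ (signPhase (f j)).val := by
  classical
  induction s using Finset.induction_on with
  | empty => simp [signPhase_zero]
  | insert a s ha ih => rw [Finset.sum_insert ha, Finset.prod_insert ha, signPhase_add, I_pow_add, ih]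

theorem qubitMatrix_apply_zero (a b : ZMod 2) : qubitMatrix a b 0 0 = if a = 0 then 1 else 0 := by
  have h : ∀ c : ZMod 2, c = 0 ∨ c = 1 := by decide
  have v1 : (1 : ZMod 2).val = 1 := by decide
  rcases h a with rfl | rfl <;> rcases h b with rfl | rfl <;> simp [qubitMatrix, v1]

theorem qubitMatrix_apply_one (b : ZMod 2) : qubitMatrix 0 b 1 1 = if b = 0 then 1 else -1 := by
  have h : ∀ c : ZMod 2, c = 0 ∨ c = 1 := by decide
  have v1 : (1 : ZMod 2).val = 1 := by decide
  rcases h b with rfl | rfl <;> simp [qubitMatrix, v1]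

theorem qubitMatrix_mul (a b c d : ZMod 2) :
    qubitMatrix a b * qubitMatrix c d =
      Complex.I ^ (signPhase (b * c)).val • qubitMatrix (a + c) (b + d) := by
  have h : ∀ c : ZMod 2, c = 0 ∨ c = 1 := by decide
  have h2 : (1 : ZMod 2) + 1 = 0 := by decide
  have v1 : (1 : ZMod 2).val = 1 := by decide
  have s1 : (signPhase 1).val = 2 := by decide
  rcases h a with rfl | rfl <;> rcases h b with rfl | rfl <;> rcases h c with rfl | rfl <;>
    rcases h d with rfl | rfl <;> ext s t <;> fin_cases s <;> fin_cases t <;>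
    simp [qubitMatrix, signPhase_zero, v1, h2, s1]

theorem toMatrix_one : toMatrix (1 : PauliGroup n) = 1 := by
  ext s t
  simp only [toMatrix, one_def, qubitMatrix, Pi.zero_apply, ZMod.val_zero, pow_zero, one_smul,
    Matrix.of_apply, mul_one, Matrix.one_apply, Finset.prod_ite_zero, Finset.prod_const_one,
    Finset.mem_univ, forall_const, funext_iff]

/-- The multiplication above is the multiplication of operators. -/
theorem toMatrix_mul (P Q : PauliGroup n) : toMatrix (P * Q) = toMatrix P * toMatrix Q := by
  have key : (Matrix.of fun s t : Fin n → Fin 2 => ∏ j, qubitMatrix (P.x j) (P.z j) (s j) (t j)) *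
      (Matrix.of fun s t : Fin n → Fin 2 => ∏ j, qubitMatrix (Q.x j) (Q.z j) (s j) (t j)) =
      Complex.I ^ (signPhase (P.z ⬝ᵥ Q.x)).val • Matrix.of fun s t : Fin n → Fin 2 =>
        ∏ j, qubitMatrix ((P.x + Q.x) j) ((P.z + Q.z) j) (s j) (t j) := by
    ext s t
    simp only [Matrix.mul_apply, Matrix.of_apply, Matrix.smul_apply, smul_eq_mul, dotProduct,
      I_pow_signPhase_sum, ← Finset.prod_mul_distrib]
    rw [← Fintype.prod_sum fun (j : Fin n) (u : Fin 2) =>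
      qubitMatrix (P.x j) (P.z j) (s j) u * qubitMatrix (Q.x j) (Q.z j) u (t j)]
    refine Finset.prod_congr rfl fun j _ => ?_
    rw [← Matrix.mul_apply, qubitMatrix_mul]
    rfl
  simp only [toMatrix, Matrix.smul_mul, Matrix.mul_smul, key, smul_smul]
  congr 1
  simp only [mul_def, I_pow_add]
  ring

/-- Distinct elements are distinct operators. -/
theorem toMatrix_injective : Function.Injective (toMatrix (n := n)) := by
  have ker : ∀ P : PauliGroup n, toMatrix P = 1 → P = 1 := by
    intro P hP
    have e0 := congrFun (congrFun hP 0) 0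
    simp only [toMatrix, Matrix.smul_apply, Matrix.of_apply, smul_eq_mul, Matrix.one_apply_eq,
      Pi.zero_apply, qubitMatrix_apply_zero] at e0
    have hx : P.x = 0 := by
      funext j
      by_contra hj
      rw [Finset.prod_eq_zero (Finset.mem_univ j), mul_zero] at e0
      · exact zero_ne_one e0
      · rw [if_neg]
        exact hj
    have hp : P.phase = 0 := by
      have e1 : Complex.I ^ P.phase.val = 1 := by simpa [hx] using e0
      have h4 : ∀ c : ZMod 4, c = 0 ∨ c = 1 ∨ c = 2 ∨ c = 3 := by decide
      have v1 : (1 : ZMod 4).val = 1 := by decide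
      have v2 : (2 : ZMod 4).val = 2 := by decide
      have v3 : (3 : ZMod 4).val = 3 := by decide
      rcases h4 P.phase with h | h | h | h
      · exact h
      all_goals
        exfalso
        rw [h] at e1
        simp [v1, v2, v3, Complex.ext_iff, pow_succ] at e1
        try norm_num at e1
    refine PauliGroup.ext hp hx (funext fun j => ?_)
    have e2 := congrFun (congrFun hP (Pi.single j 1)) (Pi.single j 1)
    simp only [toMatrix, Matrix.smul_apply, Matrix.of_apply, smul_eq_mul, Matrix.one_apply_eq,
      hx, hp, Pi.zero_apply, ZMod.val_zero, pow_zero, one_mul] at e2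
    rw [Finset.prod_eq_single j
      (fun i _ hi => by rw [Pi.single_eq_of_ne hi, qubitMatrix_apply_zero, if_pos rfl]) (by simp),
      Pi.single_eq_same, qubitMatrix_apply_one] at e2
    by_contra hz
    rw [if_neg (show ¬P.z j = 0 from hz)] at e2
    norm_num at e2
  intro P Q h
  have h1 := ker (P * Q⁻¹) (by rw [toMatrix_mul, h, ← toMatrix_mul, mul_inv_cancel, toMatrix_one])
  exact mul_inv_eq_one.mp h1

end PauliGroup

/-- A stabilizer code on `n` qubits, given by a finite family of checks (not necessarily
independent) that generate an abelian group of Pauli operators not containing `-I`. -/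
structure StabilizerCode (n : ℕ) where
  /-- the number of checks -/
  numChecks : ℕ
  /-- the checks -/
  check : Fin numChecks → PauliGroup n
  /-- the group generated by the checks is abelian -/
  commutes : ∀ P ∈ Subgroup.closure (Set.range check), ∀ Q ∈ Subgroup.closure (Set.range check),
    P * Q = Q * P
  /-- the group generated by the checks does not contain `-I` -/
  negI_notMem : PauliGroup.negI ∉ Subgroup.closure (Set.range check)

namespace StabilizerCode

variable {n : ℕ} (C : StabilizerCode n)

/-- The stabilizer group, generated by the checks. -/
def stabilizer : Subgroup (PauliGroup n) := Subgroup.closure (Set.range C.check)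

/-- The code has check weight `w`: each of its checks has weight at most `w`. -/
def HasCheckWeight (w : ℕ) : Prop := ∀ i, (C.check i).weight ≤ w

/-- The dimension, or number of logical qubits, `k = n - rank S`, where the rank of a group is the
smallest size of a generating set. It is an integer, so that the subtraction does not truncate. -/
noncomputable def dimension : ℤ := (n : ℤ) - (Group.rank C.stabilizer : ℤ)

/-- A logical operator: a Pauli operator that commutes with every stabilizer. -/
def IsLogical (P : PauliGroup n) : Prop := ∀ S ∈ C.stabilizer, P * S = S * P

/-- A nontrivial logical operator: one that is not a stabilizer up to phase. -/
def IsNontrivialLogical (P : PauliGroup n) : Prop :=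
  C.IsLogical P ∧ ∀ c : ZMod 4, PauliGroup.scalar c * P ∉ C.stabilizer

/-- The distance: the smallest weight of a nontrivial logical operator (`⊤` if there is none). -/
noncomputable def distance : ℕ∞ :=
  ⨅ (P : PauliGroup n) (_ : C.IsNontrivialLogical P), (P.weight : ℕ∞)

end StabilizerCode

/-! Up to phase, Pauli operators form a symplectic space over `ZMod 2` of dimension `2n`. The
stabilizers form an isotropic subspace `S`, and `k = 0` means that `S` is its own orthogonal. If `d
> 2`, every operator of weight at most 2 orthogonal to `S` lies in `S`.

The proof is an induction on the number of sites, in a class closed under contraction: in a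
`CostedCode` the weight is replaced by a subadditive cost on each site. Suppose that `m ≥ 2` sites
support an `(m - 1)`-dimensional space `T` of stabilizers, so that `T` encodes one qubit in this
block, and that this qubit has a nontrivial logical operator of cost at most 2. Then the block is
replaced by one site whose labels are the logical classes, each costing as much as its cheapest
representative (`exists_merged`). Generators of cost at most 3 stay that cheap, and logical
operators of cost at most 2 lift without extra cost.

If there is no such block, the code is reduced. Stabilizers on one site vanish, as do those on two
sites with cost at most 2 at one of them, so a nonzero generator lives on exactly three sites, with
cost 1 at each. Certain configurations of `m` independent generators on `m + 1` sites are
impossible, since they would force a cheap operator into `S`. It follows that no three generators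
pairwise anticommute at a site (`false_of_pairwise_form`), and then that every site `i` has a label
`p i` of cost at most 1 anticommuting with exactly one generator `q i` (`exists_form_eq_one_iff`).
If `q i = q j` for distinct sites, the product of `p i` and `p j` would be a nontrivial logical
operator of cost at most 2. So the `q i` are distinct, dual to the `p i`, and hence independent: `S`
has dimension at least the number of sites, the maximum for an isotropic space. -/

/-- A single-site Pauli operator up to phase, as its pair of `X` and `Z` exponents. -/
abbrev PauliLabel : Type := ZMod 2 × ZMod 2

/-! ### The symplectic plane of one site -/

namespace PauliLabel

/-- The commutation form on single-site Pauli operators. -/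
def form (a b : PauliLabel) : ZMod 2 := a.1 * b.2 + a.2 * b.1

theorem form_self (a : PauliLabel) : form a a = 0 := by
  revert a; decide

theorem form_comm (a b : PauliLabel) : form a b = form b a := by
  simp only [form]; ring

theorem form_zero_left (b : PauliLabel) : form 0 b = 0 := by
  simp [form]

theorem form_zero_right (a : PauliLabel) : form a 0 = 0 := by
  simp [form]

/-- In characteristic 2 the form is the `2 × 2` determinant, and determinants multiply. -/
theorem form_combination (a b v w : PauliLabel) :
    form (a.1 • v + a.2 • w) (b.1 • v + b.2 • w) = form a b * form v w := by
  have h : ∀ a1 a2 b1 b2 v1 v2 w1 w2 : ZMod 2,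
      (a1 * v1 + a2 * w1) * (b1 * v2 + b2 * w2) + (a1 * v2 + a2 * w2) * (b1 * v1 + b2 * w1) =
        (a1 * b2 + a2 * b1) * (v1 * w2 + v2 * w1) := by decide
  exact h a.1 a.2 b.1 b.2 v.1 v.2 w.1 w.2

theorem form_eq_one_of_ne {a b : PauliLabel} : a ≠ 0 → b ≠ 0 → a ≠ b → form a b = 1 := by
  revert a b; decide

theorem ne_zero_left {a b : PauliLabel} : form a b = 1 → a ≠ 0 := by
  revert a b; decide

theorem ne_zero_right {a b : PauliLabel} : form a b = 1 → b ≠ 0 := by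
  revert a b; decide

theorem ne_of_form_eq_one {a b : PauliLabel} : form a b = 1 → a ≠ b := by
  revert a b; decide

theorem exists_form_eq_one {a : PauliLabel} : a ≠ 0 → ∃ b, form a b = 1 := by
  revert a; decide

theorem eq_zero_of_smul_add_smul {a b : PauliLabel} {s t : ZMod 2} :
    form a b = 1 → s • a + t • b = 0 → s = 0 ∧ t = 0 := by
  revert a b s t; decide

theorem eq_zero_of_smul {a : PauliLabel} {s : ZMod 2} : a ≠ 0 → s • a = 0 → s = 0 := by
  revert a s; decide

theorem eq_or_eq_of_form {a b c d : PauliLabel} (hab : form a b = 1) (hac : form a c = 1)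
    (hbc : form b c = 1) (had : form a d = 1) : d = b ∨ d = c := by
  have h : ∀ a b c d : PauliLabel,
      form a b = 1 ∧ form a c = 1 ∧ form b c = 1 ∧ form a d = 1 → d = b ∨ d = c := by decide
  exact h a b c d ⟨hab, hac, hbc, had⟩

end PauliLabel

open PauliLabel (form)

theorem ZMod.two_eq_zero_or_one (a : ZMod 2) : a = 0 ∨ a = 1 := by
  revert a; decide

/-! ### The symplectic space of all sites -/

section SympForm

variable {ι : Type} [Fintype ι]

/-- The commutation form on Pauli operators up to phase, with sites indexed by `ι`. -/
def sympForm (ι : Type) [Fintype ι] : LinearMap.BilinForm (ZMod 2) (ι → PauliLabel) :=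
  LinearMap.mk₂ (ZMod 2) (fun u v => ∑ i, form (u i) (v i))
    (fun u u' v => by
      simp only [form, ← Finset.sum_add_distrib, Pi.add_apply, Prod.fst_add, Prod.snd_add]
      exact Finset.sum_congr rfl fun i _ => by ring)
    (fun c u v => by
      simp only [form, Pi.smul_apply, Prod.smul_fst, Prod.smul_snd, smul_eq_mul, Finset.mul_sum]
      exact Finset.sum_congr rfl fun i _ => by ring)
    (fun u v v' => by
      simp only [form, ← Finset.sum_add_distrib, Pi.add_apply, Prod.fst_add, Prod.snd_add]
      exact Finset.sum_congr rfl fun i _ => by ring)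
    (fun c u v => by
      simp only [form, Pi.smul_apply, Prod.smul_fst, Prod.smul_snd, smul_eq_mul, Finset.mul_sum]
      exact Finset.sum_congr rfl fun i _ => by ring)

theorem sympForm_apply (u v : ι → PauliLabel) : sympForm ι u v = ∑ i, form (u i) (v i) := rfl

theorem sympForm_comm (u v : ι → PauliLabel) : sympForm ι u v = sympForm ι v u := by
  simp only [sympForm_apply, PauliLabel.form_comm]

theorem sympForm_self (u : ι → PauliLabel) : sympForm ι u u = 0 := by
  simp [sympForm_apply, PauliLabel.form_self]

theorem sympForm_isRefl : (sympForm ι).IsRefl := fun u v h => by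
  rw [sympForm_comm]; exact h

theorem sympForm_single_left [DecidableEq ι] (i : ι) (a : PauliLabel) (v : ι → PauliLabel) :
    sympForm ι (Pi.single i a) v = form a (v i) := by
  rw [sympForm_apply, Finset.sum_eq_single i]
  · simp
  · intro j _ hj
    rw [Pi.single_eq_of_ne hj, PauliLabel.form_zero_left]
  · simp

theorem exists_sympForm_eq_one {v : ι → PauliLabel} (hv : v ≠ 0) : ∃ u, sympForm ι v u = 1 := by
  classical
  obtain ⟨i, hi⟩ := Function.ne_iff.mp hv
  obtain ⟨b, hb⟩ := PauliLabel.exists_form_eq_one hi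
  exact ⟨Pi.single i b, by rw [sympForm_comm, sympForm_single_left, PauliLabel.form_comm, hb]⟩

theorem sympForm_nondegenerate : (sympForm ι).Nondegenerate := by
  have key : ∀ v : ι → PauliLabel, (∀ u, sympForm ι v u = 0) → v = 0 := by
    intro v h
    by_contra hv
    obtain ⟨u, hu⟩ := exists_sympForm_eq_one hv
    exact zero_ne_one ((h u).symm.trans hu)
  exact ⟨key, fun v h => key v fun u => by rw [sympForm_comm]; exact h u⟩

theorem mem_sympForm_orthogonal {W : Submodule (ZMod 2) (ι → PauliLabel)} {x : ι → PauliLabel} :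
    x ∈ (sympForm ι).orthogonal W ↔ ∀ y ∈ W, sympForm ι x y = 0 := by
  rw [LinearMap.BilinForm.mem_orthogonal_iff]
  exact forall₂_congr fun y _ => by
    rw [sympForm_comm x y]

theorem finrank_labels : Module.finrank (ZMod 2) (ι → PauliLabel) = 2 * Fintype.card ι := by
  rw [Module.finrank_pi_fintype]
  simp [mul_comm]

theorem finrank_sympForm_orthogonal (W : Submodule (ZMod 2) (ι → PauliLabel)) :
    Module.finrank (ZMod 2) W + Module.finrank (ZMod 2) ((sympForm ι).orthogonal W) =
      2 * Fintype.card ι := by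
  have h := LinearMap.BilinForm.finrank_orthogonal sympForm_nondegenerate W
  have h' := Submodule.finrank_le W
  rw [finrank_labels] at h h'
  omega

/-- By nondegeneracy `W` is its own double orthogonal. -/
theorem exists_mem_orthogonal_sympForm_eq_one {W : Submodule (ZMod 2) (ι → PauliLabel)}
    {v : ι → PauliLabel} (hv : v ∉ W) : ∃ u ∈ (sympForm ι).orthogonal W, sympForm ι v u = 1 := by
  by_contra! h
  apply hv
  rw [← LinearMap.BilinForm.orthogonal_orthogonal sympForm_nondegenerate sympForm_isRefl W,
    mem_sympForm_orthogonal]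
  exact fun y hy => (ZMod.two_eq_zero_or_one _).resolve_right (h y hy)

theorem sum_eq_of_support_triple [DecidableEq ι] {f : ι → ZMod 2} {i j k : ι} (hij : i ≠ j)
    (hik : i ≠ k) (hjk : j ≠ k) (hf : ∀ l, l ≠ i → l ≠ j → l ≠ k → f l = 0) :
    ∑ l, f l = f i + f j + f k := by
  rw [← Finset.sum_subset (Finset.subset_univ {i, j, k}), Finset.sum_insert (by simp [hij, hik]),
    Finset.sum_pair hjk, add_assoc]
  intro l _ hl
  simp only [Finset.mem_insert, Finset.mem_singleton, not_or] at hl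
  exact hf l hl.1 hl.2.1 hl.2.2

end SympForm

/-- A stabilizer code up to phases in which each single-site operator has its own cost, whose
stabilizers are generated by those of cost at most `3`, and whose logical operators of cost at most
`2` are stabilizers. -/
structure CostedCode (ι : Type) [Fintype ι] where
  /-- the cost of each single-site operator -/
  cost : ι → PauliLabel → ℕ
  cost_zero : ∀ i, cost i 0 = 0
  cost_pos : ∀ i a, a ≠ 0 → 1 ≤ cost i a
  cost_add : ∀ i a b, cost i (a + b) ≤ cost i a + cost i b
  exists_cost_le_two : ∀ i, ∃ a, a ≠ 0 ∧ cost i a ≤ 2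
  /-- the stabilizers -/
  stab : Submodule (ZMod 2) (ι → PauliLabel)
  isotropic : ∀ x ∈ stab, ∀ y ∈ stab, sympForm ι x y = 0
  stab_le_span : stab ≤ Submodule.span (ZMod 2) {x | x ∈ stab ∧ ∑ i, cost i (x i) ≤ 3}
  mem_stab_of_cost_le_two : ∀ x ∈ (sympForm ι).orthogonal stab, ∑ i, cost i (x i) ≤ 2 → x ∈ stab

/-! ### Symplectic contraction of a block to one site -/

section Merge

variable {ι : Type} [DecidableEq ι]

/-- Embed operators on the sites outside `M` and one further site, whose `X` and `Z` act as `v` and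
`w`. -/
def mergeMap (M : Finset ι) (v w : ι → PauliLabel) :
    (Option {i // i ∉ M} → PauliLabel) →ₗ[ZMod 2] (ι → PauliLabel) where
  toFun u i := if h : i ∈ M then (u none).1 • v i + (u none).2 • w i else u (some ⟨i, h⟩)
  map_add' u u' := by
    funext i
    by_cases h : i ∈ M
    · simp only [h, dif_pos, Pi.add_apply, Prod.fst_add, Prod.snd_add, add_smul]
      abel
    · simp [h]
  map_smul' c u := by
    funext i
    by_cases h : i ∈ M
    · simp only [h, dif_pos, Pi.smul_apply, Prod.smul_fst, Prod.smul_snd, smul_assoc, smul_add,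
        RingHom.id_apply]
    · simp [h]

theorem mergeMap_apply_of_mem {M : Finset ι} (v w : ι → PauliLabel)
    (u : Option {i // i ∉ M} → PauliLabel) {i : ι} (hi : i ∈ M) :
    mergeMap M v w u i = (u none).1 • v i + (u none).2 • w i := dif_pos hi

theorem mergeMap_apply_of_notMem {M : Finset ι} (v w : ι → PauliLabel)
    (u : Option {i // i ∉ M} → PauliLabel) {i : ι} (hi : i ∉ M) :
    mergeMap M v w u i = u (some ⟨i, hi⟩) := dif_neg hi

variable [Fintype ι]

theorem sum_eq_sum_add_sum_notMem {R : Type*} [AddCommMonoid R] (M : Finset ι) (f : ι → R) :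
    ∑ i, f i = ∑ i ∈ M, f i + ∑ i : {i // i ∉ M}, f i := by
  rw [← Finset.sum_add_sum_compl M, Finset.sum_subtype Mᶜ (fun i => Finset.mem_compl)]

/-- By `form_combination`, summing over the block multiplies the form at the merged site by
`sympForm ι v w = 1`. -/
theorem sympForm_mergeMap {M : Finset ι} {v w : ι → PauliLabel} (hv : ∀ i ∉ M, v i = 0)
    (hvw : sympForm ι v w = 1) (u u' : Option {i // i ∉ M} → PauliLabel) :
    sympForm ι (mergeMap M v w u) (mergeMap M v w u') = sympForm _ u u' := by
  rw [sympForm_apply, sympForm_apply, Fintype.sum_option, sum_eq_sum_add_sum_notMem M]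
  congr 1
  · rw [← mul_one (form (u none) (u' none)), ← hvw, sympForm_apply,
      ← Finset.sum_subset M.subset_univ
        (fun i _ hi => by rw [hv i hi, PauliLabel.form_zero_left]), Finset.mul_sum]
    refine Finset.sum_congr rfl fun i hi => ?_
    rw [mergeMap_apply_of_mem _ _ _ hi, mergeMap_apply_of_mem _ _ _ hi,
      PauliLabel.form_combination]
  · refine Finset.sum_congr rfl fun i _ => ?_
    rw [mergeMap_apply_of_notMem _ _ _ i.2, mergeMap_apply_of_notMem _ _ _ i.2]

theorem mergeMap_injective {M : Finset ι} {v w : ι → PauliLabel} (hv : ∀ i ∉ M, v i = 0)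
    (hvw : sympForm ι v w = 1) : Function.Injective (mergeMap M v w) := by
  rw [injective_iff_map_eq_zero]
  intro u hu
  by_contra hne
  obtain ⟨u', h⟩ := exists_sympForm_eq_one hne
  rw [← sympForm_mergeMap hv hvw, hu, map_zero, LinearMap.zero_apply] at h
  exact zero_ne_one h

theorem sympForm_mergeMap_left_eq_zero {M : Finset ι} {v w t : ι → PauliLabel}
    (ht : ∀ i ∉ M, t i = 0) (hvt : sympForm ι v t = 0) (hwt : sympForm ι w t = 0)
    (u : Option {i // i ∉ M} → PauliLabel) : sympForm ι (mergeMap M v w u) t = 0 := by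
  have h : sympForm ι (mergeMap M v w u) t =
      sympForm ι ((u none).1 • v + (u none).2 • w) t := by
    rw [sympForm_apply, sympForm_apply]
    refine Finset.sum_congr rfl fun i _ => ?_
    by_cases hi : i ∈ M
    · rw [mergeMap_apply_of_mem _ _ _ hi]; rfl
    · rw [ht i hi, PauliLabel.form_zero_right, PauliLabel.form_zero_right]
  rw [h, map_add, map_smul, map_smul, LinearMap.add_apply, LinearMap.smul_apply,
    LinearMap.smul_apply, hvt, hwt, smul_zero, smul_zero, add_zero]

/-- The sum is direct because the form is nondegenerate on the range while `T` is orthogonal to it.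
With `N` sites and a block of `m`, the dimensions agree: `2 (N - m + 1) + (m - 1) = 2 N - (m - 1)`.
-/
theorem orthogonal_eq_range_mergeMap_sup {M : Finset ι} {v w : ι → PauliLabel}
    {T : Submodule (ZMod 2) (ι → PauliLabel)} (hT : ∀ t ∈ T, ∀ i ∉ M, t i = 0)
    (hTT : ∀ s ∈ T, ∀ t ∈ T, sympForm ι s t = 0) (hcard : M.card = Module.finrank (ZMod 2) T + 1)
    (hv : ∀ i ∉ M, v i = 0) (hvT : ∀ t ∈ T, sympForm ι v t = 0)
    (hwT : ∀ t ∈ T, sympForm ι w t = 0) (hvw : sympForm ι v w = 1) :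
    Disjoint (LinearMap.range (mergeMap M v w)) T ∧
      (sympForm ι).orthogonal T = LinearMap.range (mergeMap M v w) ⊔ T := by
  have hdisj : Disjoint (LinearMap.range (mergeMap M v w)) T := by
    rw [Submodule.disjoint_def]
    rintro _ ⟨u, rfl⟩ hu
    suffices u = 0 by rw [this, map_zero]
    by_contra hne
    obtain ⟨u', h⟩ := exists_sympForm_eq_one hne
    rw [← sympForm_mergeMap hv hvw, sympForm_comm,
      sympForm_mergeMap_left_eq_zero (hT _ hu) (hvT _ hu) (hwT _ hu)] at h
    exact zero_ne_one h
  refine ⟨hdisj, (Submodule.eq_of_le_of_finrank_le ?_ ?_).symm⟩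
  · refine sup_le ?_ fun t ht => mem_sympForm_orthogonal.mpr fun s hs => hTT t ht s hs
    rintro _ ⟨u, rfl⟩
    exact mem_sympForm_orthogonal.mpr fun t ht =>
      sympForm_mergeMap_left_eq_zero (hT t ht) (hvT t ht) (hwT t ht) u
  · have h1 := Submodule.finrank_sup_add_finrank_inf_eq (LinearMap.range (mergeMap M v w)) T
    rw [hdisj.eq_bot, finrank_bot,
      LinearMap.finrank_range_of_inj (mergeMap_injective hv hvw), finrank_labels] at h1
    have h2 := finrank_sympForm_orthogonal T
    have h3 : Fintype.card (Option {i // i ∉ M}) = Fintype.card ι - M.card + 1 := by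
      rw [Fintype.card_option, Fintype.card_subtype_compl]
      simp
    have h4 := M.card_le_univ
    rw [h3] at h1
    omega

end Merge

/-! ### Costs on the contracted code -/

namespace CostedCode

variable {ι : Type} [Fintype ι] (C : CostedCode ι)

/-- The total cost of an operator. -/
def weight (x : ι → PauliLabel) : ℕ := ∑ i, C.cost i (x i)

theorem weight_add_le (x y : ι → PauliLabel) : C.weight (x + y) ≤ C.weight x + C.weight y := by
  rw [weight, weight, weight, ← Finset.sum_add_distrib]
  exact Finset.sum_le_sum fun i _ => C.cost_add i _ _

theorem weight_zero : C.weight 0 = 0 :=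
  Finset.sum_eq_zero fun i _ => C.cost_zero i

theorem one_le_weight {x : ι → PauliLabel} (hx : x ≠ 0) : 1 ≤ C.weight x := by
  obtain ⟨i, hi⟩ := Function.ne_iff.mp hx
  exact (C.cost_pos i _ hi).trans
    (Finset.single_le_sum (f := fun i => C.cost i (x i)) (fun _ _ => Nat.zero_le _)
      (Finset.mem_univ i))

/-- The least cost of an operator in the class of `a` on the merged site. -/
noncomputable def mergedCost (T : Submodule (ZMod 2) (ι → PauliLabel)) (v w : ι → PauliLabel)
    (a : PauliLabel) : ℕ :=
  sInf ((fun t => C.weight (a.1 • v + a.2 • w + t)) '' (T : Set (ι → PauliLabel)))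

variable (T : Submodule (ZMod 2) (ι → PauliLabel)) (v w : ι → PauliLabel)

theorem exists_mergedCost (a : PauliLabel) :
    ∃ t ∈ T, C.weight (a.1 • v + a.2 • w + t) = C.mergedCost T v w a :=
  Nat.sInf_mem (s := (fun t => C.weight (a.1 • v + a.2 • w + t)) '' (T : Set (ι → PauliLabel)))
    ⟨_, 0, T.zero_mem, rfl⟩

theorem mergedCost_le (a : PauliLabel) {t : ι → PauliLabel} (ht : t ∈ T) :
    C.mergedCost T v w a ≤ C.weight (a.1 • v + a.2 • w + t) :=
  Nat.sInf_le ⟨t, ht, rfl⟩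

theorem mergedCost_zero : C.mergedCost T v w 0 = 0 := by
  have h := C.mergedCost_le T v w 0 T.zero_mem
  simpa [weight_zero] using h

theorem mergedCost_add (a b : PauliLabel) :
    C.mergedCost T v w (a + b) ≤ C.mergedCost T v w a + C.mergedCost T v w b := by
  obtain ⟨s, hs, hs'⟩ := C.exists_mergedCost T v w a
  obtain ⟨t, ht, ht'⟩ := C.exists_mergedCost T v w b
  rw [← hs', ← ht']
  refine (C.mergedCost_le T v w _ (T.add_mem hs ht)).trans (le_trans (le_of_eq ?_)
    (C.weight_add_le _ _))
  congr 1
  simp only [Prod.fst_add, Prod.snd_add, add_smul]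
  abel

variable {T v w} [DecidableEq ι]

theorem weight_mergeMap_add {M : Finset ι} (hv : ∀ i ∉ M, v i = 0) (hw : ∀ i ∉ M, w i = 0)
    {t : ι → PauliLabel} (ht : ∀ i ∉ M, t i = 0) (u : Option {i // i ∉ M} → PauliLabel) :
    C.weight (mergeMap M v w u + t) = C.weight ((u none).1 • v + (u none).2 • w + t) +
      ∑ i : {i // i ∉ M}, C.cost i (u (some i)) := by
  have h0 : ∑ i : {i // i ∉ M}, C.cost i (((u none).1 • v + (u none).2 • w + t) i) = 0 :=
    Finset.sum_eq_zero fun i _ => by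
      simp [hv i i.2, hw i i.2, ht i i.2, C.cost_zero]
  rw [weight, weight, sum_eq_sum_add_sum_notMem M,
    sum_eq_sum_add_sum_notMem M (fun i => C.cost i (((u none).1 • v + (u none).2 • w + t) i)),
    h0, add_zero]
  congr 1
  · refine Finset.sum_congr rfl fun i hi => ?_
    rw [Pi.add_apply, mergeMap_apply_of_mem _ _ _ hi]
    rfl
  · refine Finset.sum_congr rfl fun i _ => ?_
    rw [Pi.add_apply, mergeMap_apply_of_notMem _ _ _ i.2, ht i i.2, add_zero]

/-- The block `M`, on which the code restricts to a single logical site, can be replaced by that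
site. -/
theorem exists_merged {M : Finset ι} (hTS : T ≤ C.stab) (hT : ∀ t ∈ T, ∀ i ∉ M, t i = 0)
    (hcard : M.card = Module.finrank (ZMod 2) T + 1) (hv : ∀ i ∉ M, v i = 0)
    (hvT : ∀ t ∈ T, sympForm ι v t = 0) (hvcost : C.weight v ≤ 2) (hvnot : v ∉ T) :
    ∃ C' : CostedCode (Option {i // i ∉ M}),
      (sympForm _).orthogonal C'.stab ≤ C'.stab → (sympForm ι).orthogonal C.stab ≤ C.stab := by
  have hTT : ∀ s ∈ T, ∀ t ∈ T, sympForm ι s t = 0 := fun s hs t ht =>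
    C.isotropic s (hTS hs) t (hTS ht)
  -- The conjugate logical operator of `v`: take any operator orthogonal to `T` that anticommutes
  -- with `v` and truncate it to `M`. Pairings with operators supported on `M` do not change.
  obtain ⟨w, hw, hwT, hvw⟩ : ∃ w : ι → PauliLabel, (∀ i ∉ M, w i = 0) ∧
      (∀ t ∈ T, sympForm ι w t = 0) ∧ sympForm ι v w = 1 := by
    obtain ⟨u, hu, hvu⟩ := exists_mem_orthogonal_sympForm_eq_one hvnot
    rw [mem_sympForm_orthogonal] at hu
    have h : ∀ x : ι → PauliLabel, (∀ i ∉ M, x i = 0) →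
        sympForm ι (fun i => if i ∈ M then u i else 0) x = sympForm ι u x := by
      intro x hx
      rw [sympForm_apply, sympForm_apply]
      refine Finset.sum_congr rfl fun i _ => ?_
      by_cases hi : i ∈ M
      · rw [if_pos hi]
      · rw [hx i hi, PauliLabel.form_zero_right, PauliLabel.form_zero_right]
    exact ⟨fun i => if i ∈ M then u i else 0, fun i hi => if_neg hi,
      fun t ht => by rw [h t (hT t ht), hu t ht],
      by rw [sympForm_comm, h v hv, sympForm_comm, hvu]⟩
  obtain ⟨hdisj, horth⟩ := orthogonal_eq_range_mergeMap_sup hT hTT hcard hv hvT hwT hvw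
  have hET : ∀ u, ∀ t ∈ T, sympForm ι (mergeMap M v w u) t = 0 := fun u t ht =>
    sympForm_mergeMap_left_eq_zero (hT t ht) (hvT t ht) (hwT t ht) u
  have hdecomp : ∀ x ∈ (sympForm ι).orthogonal T, ∃ u, ∃ t ∈ T, mergeMap M v w u + t = x := by
    intro x hx
    rw [horth, Submodule.mem_sup] at hx
    obtain ⟨_, ⟨u, rfl⟩, t, ht, h⟩ := hx
    exact ⟨u, t, ht, h⟩
  have hstabT : ∀ x ∈ C.stab, x ∈ (sympForm ι).orthogonal T := fun x hx =>
    mem_sympForm_orthogonal.mpr fun t ht => C.isotropic x hx t (hTS ht)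
  let S' := C.stab.comap (mergeMap M v w)
  let cost' : Option {i // i ∉ M} → PauliLabel → ℕ := fun o =>
    o.elim (C.mergedCost T v w) fun i => C.cost i
  have hcost' : ∀ u : Option {i // i ∉ M} → PauliLabel, ∑ i, cost' i (u i) =
      C.mergedCost T v w (u none) + ∑ i : {i // i ∉ M}, C.cost i (u (some i)) := fun u =>
    Fintype.sum_option _
  have hcost_le : ∀ u, ∀ t ∈ T, ∑ i, cost' i (u i) ≤ C.weight (mergeMap M v w u + t) := by
    intro u t ht
    rw [hcost', C.weight_mergeMap_add hv hw (hT t ht)]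
    exact Nat.add_le_add_right (C.mergedCost_le T v w _ ht) _
  have hcost_eq : ∀ u, ∃ t ∈ T, C.weight (mergeMap M v w u + t) = ∑ i, cost' i (u i) := by
    intro u
    obtain ⟨t, ht, h⟩ := C.exists_mergedCost T v w (u none)
    exact ⟨t, ht, by rw [hcost', C.weight_mergeMap_add hv hw (hT t ht), h]⟩
  have horth' : ∀ u, u ∈ (sympForm _).orthogonal S' →
      ∀ t ∈ T, mergeMap M v w u + t ∈ (sympForm ι).orthogonal C.stab := by
    intro u hu t ht
    rw [mem_sympForm_orthogonal] at hu ⊢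
    intro x hx
    obtain ⟨u', t', ht', rfl⟩ := hdecomp x (hstabT x hx)
    have hu' : u' ∈ S' := by
      have h := C.stab.sub_mem hx (hTS ht')
      rwa [add_sub_cancel_right] at h
    rw [map_add, map_add, LinearMap.add_apply, LinearMap.add_apply, hTT t ht t' ht',
      hET u t' ht', sympForm_comm t, hET u' t ht, sympForm_mergeMap hv hvw, hu u' hu']
    simp
  refine ⟨⟨cost', ?_, ?_, ?_, ?_, S', ?_, ?_, ?_⟩, ?_⟩
  · rintro (_ | i)
    exacts [C.mergedCost_zero T v w, C.cost_zero i]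
  · rintro (_ | i) a ha
    · obtain ⟨t, ht, h⟩ := C.exists_mergedCost T v w a
      change 1 ≤ C.mergedCost T v w a
      rw [← h]
      apply C.one_le_weight
      intro h0
      have hmem : a.1 • v + a.2 • w ∈ T := by
        rw [eq_neg_of_add_eq_zero_left h0]
        exact T.neg_mem ht
      have h1 := hvT _ hmem
      have h2 := hwT _ hmem
      -- Pairing with `v` and `w` reads off the two coordinates of `a`, so only the zero class meets
      -- `T`.
      simp only [map_add, map_smul, sympForm_self, hvw, sympForm_comm w v, smul_eq_mul, mul_one,
        mul_zero, zero_add, add_zero] at h1 h2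
      exact ha (Prod.ext h2 h1)
    · exact C.cost_pos i a ha
  · rintro (_ | i) a b
    exacts [C.mergedCost_add T v w a b, C.cost_add i a b]
  · rintro (_ | i)
    · refine ⟨(1, 0), by decide, ?_⟩
      have h := C.mergedCost_le T v w (1, 0) T.zero_mem
      simp only [one_smul, zero_smul, add_zero] at h
      exact h.trans hvcost
    · exact C.exists_cost_le_two i
  · intro x hx y hy
    rw [← sympForm_mergeMap hv hvw]
    exact C.isotropic _ hx _ hy
  · intro u hu
    -- A cheap generator is orthogonal to `T`, hence a merged operator plus an element of `T`; the
    -- merged operator costs no more, its cost being a minimum over that coset.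
    have hle : C.stab ≤ Submodule.map (mergeMap M v w)
        (Submodule.span (ZMod 2) {x | x ∈ S' ∧ ∑ i, cost' i (x i) ≤ 3}) ⊔ T := by
      refine C.stab_le_span.trans (Submodule.span_le.mpr ?_)
      rintro x ⟨hx, hx3⟩
      obtain ⟨u', t, ht, rfl⟩ := hdecomp x (hstabT x hx)
      refine Submodule.add_mem_sup (Submodule.mem_map_of_mem (Submodule.subset_span
        ⟨?_, (hcost_le u' t ht).trans hx3⟩)) ht
      have h := C.stab.sub_mem hx (hTS ht)
      rwa [add_sub_cancel_right] at h
    obtain ⟨_, ⟨u', hu', rfl⟩, t, ht, h⟩ := Submodule.mem_sup.mp (hle hu)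
    have h0 : mergeMap M v w (u - u') = 0 := by
      refine (Submodule.disjoint_def.mp hdisj) _ ⟨_, rfl⟩ ?_
      rw [map_sub, ← h, add_sub_cancel_left]
      exact ht
    have h1 := mergeMap_injective hv hvw (h0.trans (map_zero _).symm)
    rwa [sub_eq_zero.mp h1]
  · intro u hu hu2
    -- Lift to the cheapest representative, which has the same cost.
    obtain ⟨t, ht, h⟩ := hcost_eq u
    have hmem := C.mem_stab_of_cost_le_two _ (horth' u hu t ht) (h.le.trans hu2)
    have h' := C.stab.sub_mem hmem (hTS ht)
    rwa [add_sub_cancel_right] at h'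
  · intro hC x hx
    have hxT : x ∈ (sympForm ι).orthogonal T :=
      LinearMap.BilinForm.orthogonal_le hTS hx
    obtain ⟨u, t, ht, rfl⟩ := hdecomp x hxT
    rw [mem_sympForm_orthogonal] at hx
    refine C.stab.add_mem (hC (mem_sympForm_orthogonal.mpr fun u' hu' => ?_)) (hTS ht)
    have h := hx _ hu'
    rwa [map_add, LinearMap.add_apply, sympForm_mergeMap hv hvw, sympForm_comm t,
      hET u' t ht, add_zero] at h

end CostedCode

/-! ### Reduced codes and their generators -/

namespace CostedCode

variable {ι : Type} [Fintype ι] (C : CostedCode ι)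

/-- No block of at least two sites carries a stabilizer code with one logical qubit and a nontrivial
logical operator of cost at most `2`. -/
def IsReduced : Prop :=
  ∀ (M : Finset ι) (T : Submodule (ZMod 2) (ι → PauliLabel)), T ≤ C.stab →
    (∀ t ∈ T, ∀ i ∉ M, t i = 0) → M.card = Module.finrank (ZMod 2) T + 1 → 2 ≤ M.card →
    ∀ v : ι → PauliLabel, (∀ i ∉ M, v i = 0) → (∀ t ∈ T, sympForm ι v t = 0) →
      C.weight v ≤ 2 → v ∈ T

/-- The stabilizers of cost at most `3`. -/
def gens : Set (ι → PauliLabel) := {x | x ∈ C.stab ∧ C.weight x ≤ 3}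

theorem exists_gen_of_notMem {x : ι → PauliLabel} (hx : x ∉ C.stab) (hx2 : C.weight x ≤ 2) :
    ∃ g ∈ C.gens, sympForm ι x g = 1 := by
  by_contra! h
  refine hx (C.mem_stab_of_cost_le_two x (mem_sympForm_orthogonal.mpr fun y hy => ?_) hx2)
  have hle : Submodule.span (ZMod 2) C.gens ≤ LinearMap.ker (sympForm ι x) :=
    Submodule.span_le.mpr fun g hg => (ZMod.two_eq_zero_or_one _).resolve_right (h g hg)
  exact hle (C.stab_le_span hy)

variable {C} in
-- The form in which reducedness is used below: `m` independent stabilizers on `m + 1` sites capture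
-- every cheap operator there that commutes with them.
theorem IsReduced.mem_stab_of_linearIndependent (hC : C.IsReduced) {m : ℕ} (hm : 1 ≤ m)
    {x : Fin m → ι → PauliLabel} (hx : ∀ a, x a ∈ C.stab)
    (hli : LinearIndependent (ZMod 2) x) (M : Finset ι) (hM : M.card = m + 1)
    (hsupp : ∀ a, ∀ i ∉ M, x a i = 0) {v : ι → PauliLabel}
    (hv : ∀ i ∉ M, v i = 0) (hvx : ∀ a, sympForm ι v (x a) = 0) (hv2 : C.weight v ≤ 2) :
    v ∈ C.stab := by
  have hle : Submodule.span (ZMod 2) (Set.range x) ≤ C.stab := by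
    rw [Submodule.span_le]
    rintro _ ⟨a, rfl⟩
    exact hx a
  refine hle (hC M _ hle (fun t ht i hi => ?_) ?_ (by omega) v hv (fun t ht => ?_) hv2)
  · have : Submodule.span (ZMod 2) (Set.range x) ≤
        LinearMap.ker (LinearMap.proj i : (ι → PauliLabel) →ₗ[ZMod 2] PauliLabel) := by
      rw [Submodule.span_le]
      rintro _ ⟨a, rfl⟩
      exact hsupp a i hi
    exact this ht
  · rw [hM, finrank_span_eq_card hli, Fintype.card_fin]
  · have : Submodule.span (ZMod 2) (Set.range x) ≤ LinearMap.ker (sympForm ι v) := by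
      rw [Submodule.span_le]
      rintro _ ⟨a, rfl⟩
      exact hvx a
    exact this ht

variable [DecidableEq ι]

theorem weight_single (i : ι) (a : PauliLabel) : C.weight (Pi.single i a) = C.cost i a := by
  rw [weight, Finset.sum_eq_single i]
  · rw [Pi.single_eq_same]
  · intro j _ hj
    rw [Pi.single_eq_of_ne hj, C.cost_zero]
  · simp

theorem sympForm_pair (i j : ι) (a b : PauliLabel) (x : ι → PauliLabel) :
    sympForm ι (Pi.single i a + Pi.single j b) x = form a (x i) + form b (x j) := by
  rw [map_add, LinearMap.add_apply, sympForm_single_left, sympForm_single_left]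

theorem weight_pair_le (i j : ι) (a b : PauliLabel) :
    C.weight (Pi.single i a + Pi.single j b) ≤ C.cost i a + C.cost j b := by
  refine (C.weight_add_le _ _).trans ?_
  rw [weight_single, weight_single]

variable {C}

theorem IsReduced.eq_or_eq_of_pair (hC : C.IsReduced) {i j : ι} (hij : i ≠ j)
    {x : ι → PauliLabel} (hx : x ∈ C.stab) (hsupp : ∀ k, k ≠ i → k ≠ j → x k = 0)
    {v : ι → PauliLabel} (hv : ∀ k, k ≠ i → k ≠ j → v k = 0) (hvx : sympForm ι v x = 0) (hv2 : C.weight v ≤ 2)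
    (hx0 : x ≠ 0) : v = 0 ∨ v = x := by
  have hmem : ∀ {k}, k ∉ ({i, j} : Finset ι) → k ≠ i ∧ k ≠ j := by
    intro k hk
    simpa using hk
  have hs : ∀ t ∈ Submodule.span (ZMod 2) {x}, t = 0 ∨ t = x := by
    intro t ht
    obtain ⟨c, rfl⟩ := Submodule.mem_span_singleton.mp ht
    rcases ZMod.two_eq_zero_or_one c with rfl | rfl
    · left; rw [zero_smul]
    · right; rw [one_smul]
  refine hs v (hC {i, j} _ ?_ ?_ ?_ ?_ v ?_ ?_ hv2)
  · rwa [Submodule.span_singleton_le_iff_mem]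
  · intro t ht k hk
    rcases hs t ht with rfl | rfl
    · rfl
    · exact hsupp k (hmem hk).1 (hmem hk).2
  · rw [Finset.card_pair hij, finrank_span_singleton hx0]
  · rw [Finset.card_pair hij]
  · exact fun k hk => hv k (hmem hk).1 (hmem hk).2
  · intro t ht
    rcases hs t ht with rfl | rfl
    · rw [map_zero]
    · exact hvx

variable [Nontrivial ι]

namespace IsReduced

variable (hC : C.IsReduced)

include hC

/-- Otherwise add a second site: a label of cost at most 2 there is a logical operator of the block
of two sites stabilized by `x`, and is not a multiple of `x`. -/
theorem eq_zero_of_support_singleton {x : ι → PauliLabel} (hx : x ∈ C.stab) (i : ι)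
    (hsupp : ∀ j, j ≠ i → x j = 0) : x = 0 := by
  by_contra hx0
  obtain ⟨j, hj⟩ := exists_ne i
  obtain ⟨a, ha, ha2⟩ := C.exists_cost_le_two j
  rcases hC.eq_or_eq_of_pair hj.symm hx (fun k hk _ => hsupp k hk) (v := Pi.single j a)
    (fun k _ hk => Pi.single_eq_of_ne hk _)
    (by rw [sympForm_single_left, hsupp j hj, PauliLabel.form_zero_right])
    (by rwa [weight_single]) hx0 with h | h
  · exact ha (by simpa using congrFun h j)
  · exact ha (by rw [← hsupp j hj, ← h, Pi.single_eq_same])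

/-- The restriction of `x` to `i` commutes with `x` and is cheap, so reducedness makes it `0` or
`x`; in both cases `x` lives on one site. -/
theorem eq_zero_of_support_pair {x : ι → PauliLabel} (hx : x ∈ C.stab) (i j : ι)
    (hsupp : ∀ k, k ≠ i → k ≠ j → x k = 0) (hcost : C.cost i (x i) ≤ 2) : x = 0 := by
  by_cases hij : i = j
  · subst hij
    exact hC.eq_zero_of_support_singleton hx i fun k hk => hsupp k hk hk
  by_contra hx0
  have hxi : x i ≠ 0 := fun h => hx0 <| hC.eq_zero_of_support_singleton hx j fun k hk => by
    by_cases hki : k = i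
    · rw [hki, h]
    · exact hsupp k hki hk
  rcases hC.eq_or_eq_of_pair hij hx hsupp (v := Pi.single i (x i))
    (fun k hk _ => Pi.single_eq_of_ne hk _)
    (by rw [sympForm_single_left, PauliLabel.form_self])
    (by rwa [weight_single]) hx0 with h | h
  · exact hxi (by simpa using congrFun h i)
  · refine hx0 (hC.eq_zero_of_support_singleton hx i fun k hk => ?_)
    rw [← h, Pi.single_eq_of_ne hk]

theorem exists_gen_form_eq_one (i : ι) {a : PauliLabel} (ha : a ≠ 0) (ha2 : C.cost i a ≤ 2) :
    ∃ g ∈ C.gens, form a (g i) = 1 := by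
  obtain ⟨g, hg, h⟩ := C.exists_gen_of_notMem (x := Pi.single i a) (fun hmem => ha <| by
    have h := hC.eq_zero_of_support_singleton hmem i fun j hj => Pi.single_eq_of_ne hj _
    simpa using congrFun h i) (by rwa [weight_single])
  rw [sympForm_single_left] at h
  exact ⟨g, hg, h⟩

theorem pair_notMem {i j : ι} (hij : i ≠ j) {a b : PauliLabel} (ha : a ≠ 0)
    (hcost : C.cost i a + C.cost j b ≤ 2) : Pi.single i a + Pi.single j b ∉ C.stab := by
  intro hmem
  have hi : (Pi.single i a + Pi.single j b : ι → PauliLabel) i = a := by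
    simp [Pi.single_eq_of_ne hij]
  have h := hC.eq_zero_of_support_pair hmem i j
    (fun k hki hkj => by simp [Pi.single_eq_of_ne hki, Pi.single_eq_of_ne hkj])
    (by rw [hi]; omega)
  rw [h] at hi
  exact ha hi.symm

theorem exists_gen_form_add_form {i j : ι} (hij : i ≠ j) {a b : PauliLabel} (ha : a ≠ 0)
    (hcost : C.cost i a + C.cost j b ≤ 2) :
    ∃ g ∈ C.gens, form a (g i) + form b (g j) = 1 := by
  obtain ⟨g, hg, h⟩ := C.exists_gen_of_notMem (hC.pair_notMem hij ha hcost)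
    ((C.weight_pair_le i j a b).trans hcost)
  exact ⟨g, hg, by rwa [sympForm_pair] at h⟩

/-- Each site of the support costs at least 1, so there are at most three. With two sites, one would
leave at most 2 for the other, which `eq_zero_of_support_pair` excludes; with three, every cost is
1. -/
theorem card_support_eq_three {g : ι → PauliLabel} (hg : g ∈ C.gens) (hg0 : g ≠ 0) :
    (Finset.univ.filter fun i => g i ≠ 0).card = 3 ∧ ∀ i, C.cost i (g i) ≤ 1 := by
  obtain ⟨s, hs⟩ : ∃ s, s = Finset.univ.filter fun i => g i ≠ 0 := ⟨_, rfl⟩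
  have hmem : ∀ i, i ∈ s ↔ g i ≠ 0 := by simp [hs]
  have hsum : C.weight g = ∑ i ∈ s, C.cost i (g i) :=
    (Finset.sum_subset s.subset_univ fun i _ hi => by
      rw [hmem, not_not] at hi; rw [hi, C.cost_zero]).symm
  have hpos : ∀ i ∈ s, 1 ≤ C.cost i (g i) := fun i hi => C.cost_pos i _ ((hmem i).mp hi)
  have h3 := hg.2
  rw [hsum] at h3
  have hcard : s.card ≤ 3 := by
    have h := Finset.card_nsmul_le_sum s _ 1 hpos
    rw [smul_eq_mul, mul_one] at h
    exact h.trans h3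
  have hc0 : s.card ≠ 0 := fun h => hg0 <| funext fun i => by
    by_contra hi
    rw [Finset.card_eq_zero] at h
    have := (hmem i).mpr hi
    simp [h] at this
  have hc1 : s.card ≠ 1 := by
    intro h
    obtain ⟨i, rfl⟩ := Finset.card_eq_one.mp h
    refine hg0 (hC.eq_zero_of_support_singleton hg.1 i fun j hj => ?_)
    by_contra hne
    exact hj (Finset.mem_singleton.mp ((hmem j).mpr hne))
  have hc2 : s.card ≠ 2 := by
    intro h
    obtain ⟨i, j, hij, rfl⟩ := Finset.card_eq_two.mp h
    refine hg0 (hC.eq_zero_of_support_pair hg.1 i j (fun k hki hkj => ?_) ?_)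
    · by_contra hne
      have := (hmem k).mpr hne
      simp [hki, hkj] at this
    · rw [Finset.sum_pair hij] at h3
      have := hpos j (by simp)
      omega
  have hc3 : s.card = 3 := by omega
  refine ⟨hs ▸ hc3, fun i => ?_⟩
  by_cases hi : i ∈ s
  · have h1 := Finset.add_sum_erase s (fun i => C.cost i (g i)) hi
    have h2 := Finset.card_nsmul_le_sum (s.erase i) (fun i => C.cost i (g i)) 1
      fun j hj => hpos j (Finset.mem_of_mem_erase hj)
    rw [Finset.card_erase_of_mem hi, hc3, smul_eq_mul] at h2
    omega
  · rw [hmem, not_not] at hi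
    rw [hi, C.cost_zero]
    exact Nat.zero_le _

theorem cost_gen_le_one {g : ι → PauliLabel} (hg : g ∈ C.gens) (i : ι) : C.cost i (g i) ≤ 1 := by
  by_cases hg0 : g = 0
  · rw [hg0, Pi.zero_apply, C.cost_zero]
    exact Nat.zero_le _
  · exact (hC.card_support_eq_three hg hg0).2 i

theorem exists_third {g : ι → PauliLabel} (hg : g ∈ C.gens) {i j : ι} (hij : i ≠ j)
    (hi : g i ≠ 0) (hj : g j ≠ 0) :
    ∃ k, k ≠ i ∧ k ≠ j ∧ g k ≠ 0 ∧ ∀ l, l ≠ i → l ≠ j → l ≠ k → g l = 0 := by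
  have h3 := (hC.card_support_eq_three hg fun h => hi (congrFun h i)).1
  have h1 : (((Finset.univ.filter fun i => g i ≠ 0).erase i).erase j).card = 1 := by
    rw [Finset.card_erase_of_mem (by simp [hj, hij.symm]),
      Finset.card_erase_of_mem (by simp [hi]), h3]
  obtain ⟨k, hk⟩ := Finset.card_eq_one.mp h1
  have hmem : ∀ l, (l ≠ j ∧ l ≠ i ∧ g l ≠ 0) ↔ l = k := by
    intro l
    have := Finset.ext_iff.mp hk l
    simpa using this
  obtain ⟨h1, h2, h3⟩ := (hmem k).mpr rfl
  refine ⟨k, h2, h1, h3, fun l hli hlj hlk => ?_⟩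
  by_contra hne
  exact hlk ((hmem l).mp ⟨hlj, hli, hne⟩)

theorem gen_eq_of_add_support_pair {g h : ι → PauliLabel} (hg : g ∈ C.gens) (hh : h ∈ C.gens)
    (i j : ι) (hsupp : ∀ k, k ≠ i → k ≠ j → g k + h k = 0) : g = h := by
  have h0 := hC.eq_zero_of_support_pair (C.stab.add_mem hg.1 hh.1) i j hsupp
    ((C.cost_add i _ _).trans (add_le_add (hC.cost_gen_le_one hg i) (hC.cost_gen_le_one hh i)))
  exact CharTwo.add_eq_zero.mp h0

/-- Distinct generators that agree at a site of their supports share no other site. -/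
theorem eq_zero_of_agree {g h : ι → PauliLabel} (hg : g ∈ C.gens) (hh : h ∈ C.gens)
    (hgh : g ≠ h) {i j : ι} (hi : g i = h i) (hi0 : g i ≠ 0) (hji : j ≠ i) (hj : g j ≠ 0) :
    h j = 0 := by
  by_contra hj'
  obtain ⟨k, hki, hkj, hk, hgk⟩ := hC.exists_third hg hji.symm hi0 hj
  obtain ⟨l, hli, hlj, hl, hhl⟩ := hC.exists_third hh hji.symm (hi ▸ hi0) hj'
  -- If they also agree at `j`, then `g + h` lives on the two third sites. If not, they anticommute
  -- at `j`, so they must anticommute again at a common third site, and `g + h` lives on `j` and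
  -- that site.
  by_cases hne : g j = h j
  · refine hgh (hC.gen_eq_of_add_support_pair hg hh k l fun m hmk hml => ?_)
    by_cases hmi : m = i
    · rw [hmi, hi, CharTwo.add_self_eq_zero]
    by_cases hmj : m = j
    · rw [hmj, hne, CharTwo.add_self_eq_zero]
    rw [hgk m hmi hmj hmk, hhl m hmi hmj hml, add_zero]
  · have hf := C.isotropic g hg.1 h hh.1
    rw [sympForm_apply, sum_eq_of_support_triple hji.symm hki.symm hkj.symm (fun m h1 h2 h3 => by
      rw [hgk m h1 h2 h3, PauliLabel.form_zero_left]), hi, PauliLabel.form_self,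
      PauliLabel.form_eq_one_of_ne hj hj' hne] at hf
    have hkl : k = l := by
      by_contra hkl
      rw [hhl k hki hkj hkl, PauliLabel.form_zero_right] at hf
      exact absurd hf (by decide)
    refine hgh (hC.gen_eq_of_add_support_pair hg hh j k fun m hmj hmk => ?_)
    by_cases hmi : m = i
    · rw [hmi, hi, CharTwo.add_self_eq_zero]
    rw [hgk m hmi hmj hmk, hhl m hmi hmj (hkl ▸ hmk), add_zero]

/-- Generators that anticommute at a site anticommute at exactly one other site, and their supports
share no third site. -/
theorem exists_shared {g h : ι → PauliLabel} (hg : g ∈ C.gens) (hh : h ∈ C.gens) {i : ι}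
    (hi : form (g i) (h i) = 1) :
    ∃ j, j ≠ i ∧ form (g j) (h j) = 1 ∧ ∀ k, k ≠ i → k ≠ j → g k ≠ 0 → h k = 0 := by
  have hf := C.isotropic g hg.1 h hh.1
  rw [sympForm_apply] at hf
  obtain ⟨j, hji, hj⟩ : ∃ j, j ≠ i ∧ form (g j) (h j) = 1 := by
    by_contra! hno
    rw [Finset.sum_eq_single i (fun j _ hj => (ZMod.two_eq_zero_or_one _).resolve_right (hno j hj))
      (by simp), hi] at hf
    exact one_ne_zero hf
  refine ⟨j, hji, hj, fun k hki hkj hk => ?_⟩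
  by_contra hk'
  have hgi := PauliLabel.ne_zero_left hi
  have hgj := PauliLabel.ne_zero_left hj
  -- Agreement at `k` would forbid sharing `i`; disagreement would give three anticommuting sites,
  -- an odd number.
  by_cases hne : g k = h k
  · exact PauliLabel.ne_zero_right hi (hC.eq_zero_of_agree hg hh
      (fun h => PauliLabel.ne_of_form_eq_one hi (congrFun h i)) hne hk hki.symm hgi)
  · obtain ⟨l, hli, hlj, hl, hgl⟩ := hC.exists_third hg hji.symm hgi hgj
    have hkl : k = l := by
      by_contra hkl
      exact hk (hgl k hki hkj hkl)
    subst hkl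
    rw [sum_eq_of_support_triple hji.symm hki.symm hkj.symm (fun m h1 h2 h3 => by
      rw [hgl m h1 h2 h3, PauliLabel.form_zero_left]), hi, hj,
      PauliLabel.form_eq_one_of_ne hk hk' hne] at hf
    exact absurd hf (by decide)

/-! ### Impossible configurations of generators -/

theorem false_of_tetrahedron {A B E : ι → PauliLabel} (hA : A ∈ C.gens) (hB : B ∈ C.gens)
    (hE : E ∈ C.gens) {i j k l : ι} (hij : i ≠ j) (hik : i ≠ k) (hil : i ≠ l) (hjk : j ≠ k)
    (hjl : j ≠ l) (hkl : k ≠ l) (sA : ∀ s, s ≠ i → s ≠ j → s ≠ k → A s = 0)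
    (sB : ∀ s, s ≠ i → s ≠ j → s ≠ l → B s = 0) (sE : ∀ s, s ≠ i → s ≠ k → s ≠ l → E s = 0)
    (hAB : form (A j) (B j) = 1) (hAE : form (A k) (E k) = 1) (hBE : form (B l) (E l) = 1) :
    False := by
  have Al := sA l hil.symm hjl.symm hkl.symm
  have Bk := sB k hik.symm hjk.symm hkl
  have Ej := sE j hij.symm hjk hjl
  -- The operator `B j` at `j` times `E k` at `k` has cost at most 2. It anticommutes with `A` at
  -- both sites and so commutes with it; `B` and `E` each meet it only where they agree with it.
  -- Three generators on four sites thus force it into the stabilizer.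
  refine hC.pair_notMem hjk (PauliLabel.ne_zero_right hAB)
    (add_le_add (hC.cost_gen_le_one hB j) (hC.cost_gen_le_one hE k))
    (hC.mem_stab_of_linearIndependent (m := 3) (x := ![A, B, E]) (by norm_num) ?_ ?_ {i, j, k, l}
      ?_ ?_ ?_ ?_ ((C.weight_pair_le _ _ _ _).trans
        (add_le_add (hC.cost_gen_le_one hB j) (hC.cost_gen_le_one hE k))))
  · intro a
    fin_cases a
    exacts [hA.1, hB.1, hE.1]
  · rw [Fintype.linearIndependent_iff]
    intro c hc
    simp only [Fin.sum_univ_three, Matrix.cons_val] at hc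
    obtain ⟨h1, h2⟩ := PauliLabel.eq_zero_of_smul_add_smul (s := c 1) (t := c 2) hBE
      (by simpa [Al] using congrFun hc l)
    have h0 := PauliLabel.eq_zero_of_smul (s := c 0) (PauliLabel.ne_zero_left hAB)
      (by simpa [h1, h2] using congrFun hc j)
    intro a
    fin_cases a
    exacts [h0, h1, h2]
  · simp [hij, hik, hil, hjk, hjl, hkl]
  · intro a s hs
    simp only [Finset.mem_insert, Finset.mem_singleton, not_or] at hs
    obtain ⟨h1, h2, h3, h4⟩ := hs
    fin_cases a
    exacts [sA s h1 h2 h3, sB s h1 h2 h4, sE s h1 h3 h4]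
  · intro s hs
    simp only [Finset.mem_insert, Finset.mem_singleton, not_or] at hs
    simp [Pi.single_eq_of_ne hs.2.1, Pi.single_eq_of_ne hs.2.2.1]
  · intro a
    rw [sympForm_pair]
    fin_cases a
    · change form (B j) (A j) + form (E k) (A k) = 0
      rw [PauliLabel.form_comm, hAB, PauliLabel.form_comm, hAE]
      decide
    · change form (B j) (B j) + form (E k) (B k) = 0
      rw [PauliLabel.form_self, Bk, PauliLabel.form_zero_right, add_zero]
    · change form (B j) (E j) + form (E k) (E k) = 0
      rw [PauliLabel.form_self, Ej, PauliLabel.form_zero_right, add_zero]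

theorem false_of_square {A B D E : ι → PauliLabel} (hA : A ∈ C.gens) (hB : B ∈ C.gens)
    (hD : D ∈ C.gens) (hE : E ∈ C.gens) {i j k l m : ι} (hij : i ≠ j) (hik : i ≠ k) (hil : i ≠ l)
    (him : i ≠ m) (hjk : j ≠ k) (hjl : j ≠ l) (hjm : j ≠ m) (hkl : k ≠ l) (hkm : k ≠ m)
    (hlm : l ≠ m) (sA : ∀ s, s ≠ i → s ≠ j → s ≠ k → A s = 0)
    (sB : ∀ s, s ≠ i → s ≠ j → s ≠ l → B s = 0) (sD : ∀ s, s ≠ i → s ≠ k → s ≠ m → D s = 0)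
    (sE : ∀ s, s ≠ i → s ≠ l → s ≠ m → E s = 0) (hAB : form (A j) (B j) = 1)
    (hAD : form (A k) (D k) = 1) (hBE : form (B l) (E l) = 1) : False := by
  have Al := sA l hil.symm hjl.symm hkl.symm
  have Bk := sB k hik.symm hjk.symm hkl
  have Dj := sD j hij.symm hjk hjm
  have Dl := sD l hil.symm hkl.symm hlm
  have Ej := sE j hij.symm hjl hjm
  have Ek := sE k hik.symm hkl hkm
  -- The same argument with `B j` at `j` and `D k` at `k`; `E` vanishes at both sites. There are
  -- four generators on five sites.
  refine hC.pair_notMem hjk (PauliLabel.ne_zero_right hAB)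
    (add_le_add (hC.cost_gen_le_one hB j) (hC.cost_gen_le_one hD k))
    (hC.mem_stab_of_linearIndependent (m := 4) (x := ![A, B, D, E]) (by norm_num) ?_ ?_
      {i, j, k, l, m} ?_ ?_ ?_ ?_ ((C.weight_pair_le _ _ _ _).trans
        (add_le_add (hC.cost_gen_le_one hB j) (hC.cost_gen_le_one hD k))))
  · intro a
    fin_cases a
    exacts [hA.1, hB.1, hD.1, hE.1]
  · rw [Fintype.linearIndependent_iff]
    intro c hc
    simp only [Fin.sum_univ_four, Matrix.cons_val] at hc
    obtain ⟨h0, h1⟩ := PauliLabel.eq_zero_of_smul_add_smul (s := c 0) (t := c 1) hAB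
      (by simpa [Dj, Ej] using congrFun hc j)
    have h2 := PauliLabel.eq_zero_of_smul (s := c 2) (PauliLabel.ne_zero_right hAD)
      (by simpa [h0, h1, Ek] using congrFun hc k)
    have h3 := PauliLabel.eq_zero_of_smul (s := c 3) (PauliLabel.ne_zero_right hBE)
      (by simpa [h0, h1, h2] using congrFun hc l)
    intro a
    fin_cases a
    exacts [h0, h1, h2, h3]
  · simp [hij, hik, hil, him, hjk, hjl, hjm, hkl, hkm, hlm]
  · intro a s hs
    simp only [Finset.mem_insert, Finset.mem_singleton, not_or] at hs
    obtain ⟨h1, h2, h3, h4, h5⟩ := hs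
    fin_cases a
    exacts [sA s h1 h2 h3, sB s h1 h2 h4, sD s h1 h3 h5, sE s h1 h4 h5]
  · intro s hs
    simp only [Finset.mem_insert, Finset.mem_singleton, not_or] at hs
    simp [Pi.single_eq_of_ne hs.2.1, Pi.single_eq_of_ne hs.2.2.1]
  · intro a
    rw [sympForm_pair]
    fin_cases a
    · change form (B j) (A j) + form (D k) (A k) = 0
      rw [PauliLabel.form_comm, hAB, PauliLabel.form_comm, hAD]
      decide
    · change form (B j) (B j) + form (D k) (B k) = 0
      rw [PauliLabel.form_self, Bk, PauliLabel.form_zero_right, add_zero]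
    · change form (B j) (D j) + form (D k) (D k) = 0
      rw [PauliLabel.form_self, Dj, PauliLabel.form_zero_right, add_zero]
    · change form (B j) (E j) + form (D k) (E k) = 0
      rw [Ej, Ek, PauliLabel.form_zero_right, PauliLabel.form_zero_right, add_zero]

/-- Site `l` is met by `B` alone, so `B l` placed at `l` commutes with all four generators; on five
sites they force this one-site operator into the stabilizer. -/
theorem false_of_book {A B D E : ι → PauliLabel} (hA : A ∈ C.gens) (hB : B ∈ C.gens)
    (hD : D ∈ C.gens) (hE : E ∈ C.gens) {i j k l m : ι} (hij : i ≠ j) (hik : i ≠ k) (hil : i ≠ l)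
    (him : i ≠ m) (hjk : j ≠ k) (hjl : j ≠ l) (hjm : j ≠ m) (hkl : k ≠ l) (hkm : k ≠ m)
    (hlm : l ≠ m) (sA : ∀ s, s ≠ i → s ≠ j → s ≠ k → A s = 0)
    (sB : ∀ s, s ≠ i → s ≠ j → s ≠ l → B s = 0) (sE : ∀ s, s ≠ i → s ≠ j → s ≠ m → E s = 0)
    (sD : ∀ s, s ≠ i → s ≠ k → s ≠ m → D s = 0) (hAE : form (A j) (E j) = 1) (hBl : B l ≠ 0)
    (hDk : D k ≠ 0) : False := by
  have Al := sA l hil.symm hjl.symm hkl.symm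
  have El := sE l hil.symm hjl.symm hlm
  have Dl := sD l hil.symm hkl.symm hlm
  have Dj := sD j hij.symm hjk hjm
  have Bk := sB k hik.symm hjk.symm hkl
  have hmem : Pi.single l (B l) ∈ C.stab := by
    refine hC.mem_stab_of_linearIndependent (m := 4) (x := ![A, B, D, E]) (by norm_num) ?_ ?_
      {i, j, k, l, m} ?_ ?_ ?_ ?_ (by
        rw [weight_single]; exact (hC.cost_gen_le_one hB l).trans (by norm_num))
    · intro a
      fin_cases a
      exacts [hA.1, hB.1, hD.1, hE.1]
    · rw [Fintype.linearIndependent_iff]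
      intro c hc
      simp only [Fin.sum_univ_four, Matrix.cons_val] at hc
      have h1 := PauliLabel.eq_zero_of_smul (s := c 1) hBl
        (by simpa [Al, Dl, El] using congrFun hc l)
      obtain ⟨h0, h3⟩ := PauliLabel.eq_zero_of_smul_add_smul (s := c 0) (t := c 3) hAE
        (by simpa [Dj, h1] using congrFun hc j)
      have h2 := PauliLabel.eq_zero_of_smul (s := c 2) hDk
        (by simpa [h0, h1, h3] using congrFun hc k)
      intro a
      fin_cases a
      exacts [h0, h1, h2, h3]
    · simp [hij, hik, hil, him, hjk, hjl, hjm, hkl, hkm, hlm]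
    · intro a s hs
      simp only [Finset.mem_insert, Finset.mem_singleton, not_or] at hs
      obtain ⟨h1, h2, h3, h4, h5⟩ := hs
      fin_cases a
      exacts [sA s h1 h2 h3, sB s h1 h2 h4, sD s h1 h3 h5, sE s h1 h2 h5]
    · intro s hs
      simp only [Finset.mem_insert, Finset.mem_singleton, not_or] at hs
      exact Pi.single_eq_of_ne hs.2.2.2.1 _
    · intro a
      rw [sympForm_single_left]
      fin_cases a
      · change form (B l) (A l) = 0
        rw [Al, PauliLabel.form_zero_right]
      · exact PauliLabel.form_self _
      · change form (B l) (D l) = 0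
        rw [Dl, PauliLabel.form_zero_right]
      · change form (B l) (E l) = 0
        rw [El, PauliLabel.form_zero_right]
  have h := hC.eq_zero_of_support_singleton hmem l fun s hs => Pi.single_eq_of_ne hs _
  exact hBl (by simpa using congrFun h l)

/-- Three generators that pairwise anticommute at two sites `i` and `j`, and a fourth one that meets
the first at its third site. -/
theorem false_of_shared_pair_of_agree {A B D E : ι → PauliLabel} (hA : A ∈ C.gens)
    (hB : B ∈ C.gens) (hE : E ∈ C.gens) (hD : D ∈ C.gens) {i j k : ι} (hij : i ≠ j) (hik : i ≠ k)
    (hjk : j ≠ k) (hABi : form (A i) (B i) = 1) (hAEi : form (A i) (E i) = 1)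
    (hBEi : form (B i) (E i) = 1) (hABj : form (A j) (B j) = 1) (hAEj : form (A j) (E j) = 1)
    (hBEj : form (B j) (E j) = 1) (sA : ∀ s, s ≠ i → s ≠ j → s ≠ k → A s = 0) (hAk : A k ≠ 0)
    (hDk : D k ≠ 0) (hDi : D i = B i) (hDj : D j = 0) : False := by
  have nAi := PauliLabel.ne_zero_left hABi
  have nBi := PauliLabel.ne_zero_right hABi
  have nEi := PauliLabel.ne_zero_right hAEi
  have nAj := PauliLabel.ne_zero_left hABj
  have nBj := PauliLabel.ne_zero_right hABj
  have nEj := PauliLabel.ne_zero_right hAEj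
  have unique : ∀ g h : ι → PauliLabel, g ∈ C.gens → h ∈ C.gens → form (g i) (h i) = 1 →
      form (g j) (h j) = 1 → ∀ s, s ≠ i → s ≠ j → g s ≠ 0 → h s = 0 := by
    intro g h hg hh hi hj s hsi hsj
    obtain ⟨j', hj'i, -, hu⟩ := hC.exists_shared hg hh hi
    have : j' = j := by
      by_contra hne
      exact PauliLabel.ne_zero_right hj
        (hu j hij.symm (Ne.symm hne) (PauliLabel.ne_zero_left hj))
    exact hu s hsi (this ▸ hsj)
  obtain ⟨l, hli, hlj, hl, sB⟩ := hC.exists_third hB hij nBi nBj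
  obtain ⟨m, hmi, hmj, hm, sE⟩ := hC.exists_third hE hij nEi nEj
  have hkl : k ≠ l := by
    rintro rfl
    exact hl (unique A B hA hB hABi hABj k hli hlj hAk)
  have hkm : k ≠ m := by
    rintro rfl
    exact hm (unique A E hA hE hAEi hAEj k hmi hmj hAk)
  have hlm : l ≠ m := by
    rintro rfl
    exact hm (unique B E hB hE hBEi hBEj l hmi hmj hl)
  -- `D` agrees with `B` at `i`, so it anticommutes with `E` there and again elsewhere. As `D`
  -- misses `j`, this is the third site of `E`, and `D` lives on `i`, `k` and that site.
  obtain ⟨s, hsi, hs, -⟩ := hC.exists_shared hD hE (i := i) (by rw [hDi, hBEi])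
  have hsm : s = m := by
    by_contra hsm
    have hsj : s ≠ j := by
      rintro rfl
      exact PauliLabel.ne_zero_left hs hDj
    exact PauliLabel.ne_zero_right hs (sE s hsi hsj hsm)
  subst hsm
  obtain ⟨r, hri, hrk, hr, sD⟩ := hC.exists_third hD hik (hDi ▸ nBi) hDk
  have hrs : r = s := by
    by_contra hrs
    exact PauliLabel.ne_zero_left hs (sD s hmi hkm.symm (Ne.symm hrs))
  subst hrs
  exact hC.false_of_book hA hB hD hE hij hik hli.symm hmi.symm hjk hlj.symm hmj.symm hkl hkm hlm
    sA sB sE sD hAEj hl hDk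

/-- `D` must anticommute with `A` again, necessarily at the third site of `A`, so `D` misses `j`. At
`i` it equals `B` or `E`, which play symmetric roles. -/
theorem false_of_shared_pair_of_form {A B D E : ι → PauliLabel} (hA : A ∈ C.gens)
    (hB : B ∈ C.gens) (hE : E ∈ C.gens) (hD : D ∈ C.gens) {i j : ι} (hij : i ≠ j)
    (hABi : form (A i) (B i) = 1) (hAEi : form (A i) (E i) = 1)
    (hBEi : form (B i) (E i) = 1) (hABj : form (A j) (B j) = 1) (hAEj : form (A j) (E j) = 1)
    (hBEj : form (B j) (E j) = 1) (hADi : form (A i) (D i) = 1) (hADj : form (A j) (D j) = 0) :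
    False := by
  obtain ⟨k, hki, hkj, hk, sA⟩ := hC.exists_third hA hij (PauliLabel.ne_zero_left hABi)
    (PauliLabel.ne_zero_left hABj)
  obtain ⟨s, hsi, hs, hu⟩ := hC.exists_shared hA hD hADi
  have hsj : s ≠ j := by
    rintro rfl
    exact zero_ne_one (hADj.symm.trans hs)
  have hsk : s = k := by
    by_contra hsk
    exact PauliLabel.ne_zero_left hs (sA s hsi hsj hsk)
  subst hsk
  have hDj := hu j hij.symm hsj.symm (PauliLabel.ne_zero_left hABj)
  have hDk := PauliLabel.ne_zero_right hs
  rcases PauliLabel.eq_or_eq_of_form hABi hAEi hBEi hADi with h | h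
  · exact hC.false_of_shared_pair_of_agree hA hB hE hD hij hki.symm hkj.symm hABi hAEi hBEi hABj
      hAEj hBEj sA hk hDk h hDj
  · exact hC.false_of_shared_pair_of_agree hA hE hB hD hij hki.symm hkj.symm hAEi hABi
      (by rw [PauliLabel.form_comm, hBEi]) hAEj hABj (by rw [PauliLabel.form_comm, hBEj])
      sA hk hDk h hDj

/-- The restriction of `A` to `i` and `j` has cost at most 2 and is not a stabilizer, so some
generator anticommutes with it, hence at exactly one of the two sites. -/
theorem exists_form_ne_form {A : ι → PauliLabel} (hA : A ∈ C.gens) {i j : ι} (hij : i ≠ j)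
    (hi : A i ≠ 0) : ∃ D ∈ C.gens, form (A i) (D i) = 1 ∧ form (A j) (D j) = 0 ∨
      form (A j) (D j) = 1 ∧ form (A i) (D i) = 0 := by
  obtain ⟨D, hD, h⟩ := hC.exists_gen_form_add_form hij hi
    (add_le_add (hC.cost_gen_le_one hA i) (hC.cost_gen_le_one hA j))
  have hcases : ∀ s t : ZMod 2, s + t = 1 → s = 1 ∧ t = 0 ∨ t = 1 ∧ s = 0 := by decide
  exact ⟨D, hD, hcases _ _ h⟩

/-- No three generators pairwise anticommute at one site. -/
theorem false_of_pairwise_form {A B E : ι → PauliLabel} (hA : A ∈ C.gens) (hB : B ∈ C.gens)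
    (hE : E ∈ C.gens) {i : ι} (hAB : form (A i) (B i) = 1) (hAE : form (A i) (E i) = 1)
    (hBE : form (B i) (E i) = 1) : False := by
  obtain ⟨j, hji, hABj, uAB⟩ := hC.exists_shared hA hB hAB
  obtain ⟨k, hki, hAEk, uAE⟩ := hC.exists_shared hA hE hAE
  obtain ⟨l, hli, hBEl, uBE⟩ := hC.exists_shared hB hE hBE
  have nAi := PauliLabel.ne_zero_left hAB
  have nBi := PauliLabel.ne_zero_right hAB
  have nEi := PauliLabel.ne_zero_right hAE
  have nAj := PauliLabel.ne_zero_left hABj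
  have nBj := PauliLabel.ne_zero_right hABj
  have nAk := PauliLabel.ne_zero_left hAEk
  have nEk := PauliLabel.ne_zero_right hAEk
  have nBl := PauliLabel.ne_zero_left hBEl
  have nEl := PauliLabel.ne_zero_right hBEl
  -- If two of the second shared sites coincide, all three do, and a generator separating `i` from
  -- `j` gives a contradiction. Otherwise the supports are three faces of a tetrahedron.
  by_cases hjk : j = k
  · subst hjk
    have hjl : j = l := by
      by_contra hjl
      exact nEk (uBE j hji hjl nBj)
    subst hjl
    obtain ⟨D, hD, ⟨hADi, hADj⟩ | ⟨hADj, hADi⟩⟩ := hC.exists_form_ne_form hA hji.symm nAi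
    · exact hC.false_of_shared_pair_of_form hA hB hE hD hji.symm hAB hAE hBE hABj hAEk hBEl hADi
        hADj
    · exact hC.false_of_shared_pair_of_form hA hB hE hD hji hABj hAEk hBEl hAB hAE hBE hADj hADi
  · have hjl : j ≠ l := by
      rintro rfl
      exact nEl (uAE j hji hjk nAj)
    have hkl : k ≠ l := by
      rintro rfl
      exact nBl (uAB k hki (Ne.symm hjk) nAk)
    obtain ⟨a, -, -, -, sA⟩ := hC.exists_third hA hji.symm nAi nAj
    obtain ⟨b, -, -, -, sB⟩ := hC.exists_third hB hji.symm nBi nBj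
    obtain ⟨e, -, -, -, sE⟩ := hC.exists_third hE hki.symm nEi nEk
    have ha : k = a := by
      by_contra h
      exact nAk (sA k hki (Ne.symm hjk) h)
    have hb : l = b := by
      by_contra h
      exact nBl (sB l hli hjl.symm h)
    have he : l = e := by
      by_contra h
      exact nEl (sE l hli hkl.symm h)
    subst ha hb he
    exact hC.false_of_tetrahedron hA hB hE hji.symm hki.symm hli.symm hjk hjl hkl sA sB sE hABj
      hAEk hBEl

/-- If `A` anticommutes at a site with two generators that agree there, it is the only generator
that anticommutes with them there. -/
theorem eq_of_form_eq_one {A B D E : ι → PauliLabel} (hA : A ∈ C.gens) (hB : B ∈ C.gens)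
    (hD : D ∈ C.gens) (hE : E ∈ C.gens) {i : ι} (hAB : form (A i) (B i) = 1) (hBD : B i = D i)
    (hne : B ≠ D) (hBE : form (B i) (E i) = 1) : E = A := by
  have hAD : form (A i) (D i) = 1 := hBD ▸ hAB
  have nAi := PauliLabel.ne_zero_left hAB
  have nBi := PauliLabel.ne_zero_right hAB
  have nDi := PauliLabel.ne_zero_right hAD
  have nEi := PauliLabel.ne_zero_right hBE
  by_contra hEA
  by_cases hAE : A i = E i
  -- The pairs `A, E` and `B, D` each agree at `i`, so they share no other site. The four second
  -- anticommutation sites are therefore distinct and form a square around `i`.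
  · obtain ⟨j, hji, hABj, uAB⟩ := hC.exists_shared hA hB hAB
    obtain ⟨k, hki, hADk, uAD⟩ := hC.exists_shared hA hD hAD
    obtain ⟨l, hli, hBEl, uBE⟩ := hC.exists_shared hB hE hBE
    obtain ⟨m, hmi, hDEm, uDE⟩ := hC.exists_shared hD hE (hBD ▸ hBE)
    have nAj := PauliLabel.ne_zero_left hABj
    have nBj := PauliLabel.ne_zero_right hABj
    have nAk := PauliLabel.ne_zero_left hADk
    have nDk := PauliLabel.ne_zero_right hADk
    have nBl := PauliLabel.ne_zero_left hBEl
    have nEl := PauliLabel.ne_zero_right hBEl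
    have nDm := PauliLabel.ne_zero_left hDEm
    have nEm := PauliLabel.ne_zero_right hDEm
    have dBD : ∀ {s}, s ≠ i → B s ≠ 0 → D s ≠ 0 → False := fun hs hb hd =>
      hd (hC.eq_zero_of_agree hB hD hne hBD nBi hs hb)
    have dAE : ∀ {s}, s ≠ i → A s ≠ 0 → E s ≠ 0 → False := fun hs ha he =>
      he (hC.eq_zero_of_agree hA hE (Ne.symm hEA) hAE nAi hs ha)
    have hjk : j ≠ k := by
      rintro rfl
      exact dBD hji nBj nDk
    have hjl : j ≠ l := by
      rintro rfl
      exact dAE hji nAj nEl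
    have hjm : j ≠ m := by
      rintro rfl
      exact dAE hji nAj nEm
    have hkl : k ≠ l := by
      rintro rfl
      exact dAE hki nAk nEl
    have hkm : k ≠ m := by
      rintro rfl
      exact dAE hki nAk nEm
    have hlm : l ≠ m := by
      rintro rfl
      exact dBD hli nBl nDm
    have support : ∀ {g : ι → PauliLabel}, g ∈ C.gens → ∀ {a b}, a ≠ i → b ≠ i → a ≠ b →
        g i ≠ 0 → g a ≠ 0 → g b ≠ 0 → ∀ s, s ≠ i → s ≠ a → s ≠ b → g s = 0 := by
      intro g hg a b ha hb hab ni na nb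
      obtain ⟨c, -, -, -, hc⟩ := hC.exists_third hg ha.symm ni na
      have hbc : b = c := by
        by_contra h
        exact nb (hc b hb hab.symm h)
      exact hbc ▸ hc
    exact hC.false_of_square hA hB hD hE hji.symm hki.symm hli.symm hmi.symm hjk hjl hjm hkl hkm
      hlm (support hA hji hki hjk nAi nAj nAk) (support hB hji hli hjl nBi nBj nBl)
      (support hD hki hmi hkm nDi nDk nDm) (support hE hli hmi hlm nEi nEl nEm) hABj hADk hBEl
  · exact hC.false_of_pairwise_form hA hB hE hAB (PauliLabel.form_eq_one_of_ne nAi nEi hAE) hBE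

/-- At every site some operator of cost at most `1` anticommutes with exactly one generator. -/
theorem exists_form_eq_one_iff (i : ι) : ∃ p : PauliLabel, p ≠ 0 ∧ C.cost i p ≤ 1 ∧
    ∃ q ∈ C.gens, ∀ g ∈ C.gens, form p (g i) = 1 ↔ g = q := by
  obtain ⟨a, ha, ha2⟩ := C.exists_cost_le_two i
  obtain ⟨A, hA, h⟩ := hC.exists_gen_form_eq_one i ha ha2
  have nAi := PauliLabel.ne_zero_right h
  obtain ⟨B, hB, hAB⟩ := hC.exists_gen_form_eq_one i nAi
    ((hC.cost_gen_le_one hA i).trans (by norm_num))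
  obtain ⟨j, hji, hABj, -⟩ := hC.exists_shared hA hB hAB
  have agree : ∀ {g h h' : ι → PauliLabel} {s : ι}, g ∈ C.gens → h ∈ C.gens → h' ∈ C.gens →
      form (g s) (h s) = 1 → form (g s) (h' s) = 1 → h s = h' s := by
    intro g h h' s hg hh hh' h1 h2
    by_contra hne
    exact hC.false_of_pairwise_form hg hh hh' h1 h2 (PauliLabel.form_eq_one_of_ne
      (PauliLabel.ne_zero_right h1) (PauliLabel.ne_zero_right h2) hne)
  have conclude : ∀ {g h h' : ι → PauliLabel}, g ∈ C.gens → h ∈ C.gens → h' ∈ C.gens →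
      form (g i) (h i) = 1 → form (g i) (h' i) = 1 → h ≠ h' →
      ∃ p : PauliLabel, p ≠ 0 ∧ C.cost i p ≤ 1 ∧
        ∃ q ∈ C.gens, ∀ g ∈ C.gens, form p (g i) = 1 ↔ g = q := by
    intro g h h' hg hh hh' h1 h2 hne
    refine ⟨h i, PauliLabel.ne_zero_right h1, hC.cost_gen_le_one hh i, g, hg, fun e he => ⟨fun h3 =>
      hC.eq_of_form_eq_one hg hh hh' he h1 (agree hg hh hh' h1 h2) hne h3, ?_⟩⟩
    rintro rfl
    rw [PauliLabel.form_comm, h1]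
  have hBA : form (B i) (A i) = 1 := by rw [PauliLabel.form_comm, hAB]
  have hBAj : form (B j) (A j) = 1 := by rw [PauliLabel.form_comm, hABj]
  -- `conclude` needs two distinct generators anticommuting with a third at `i`. If neither `A` nor
  -- `B` is such a third, the separating generators `D` and `E` both act through `j`.
  obtain ⟨D, hD, ⟨hADi, hADj⟩ | ⟨hADj, hADi⟩⟩ := hC.exists_form_ne_form hA hji.symm nAi
  · refine conclude hA hB hD hAB hADi ?_
    rintro rfl
    exact zero_ne_one (hADj.symm.trans hABj)
  obtain ⟨E, hE, ⟨hBEi, hBEj⟩ | ⟨hBEj, hBEi⟩⟩ :=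
    hC.exists_form_ne_form hB hji.symm (PauliLabel.ne_zero_right hAB)
  · refine conclude hB hA hE hBA hBEi ?_
    rintro rfl
    exact zero_ne_one (hBEj.symm.trans hBAj)
  have hBD : B ≠ D := by
    rintro rfl
    exact zero_ne_one (hADi.symm.trans hAB)
  -- At `j`, the distinct `B` and `D` agree and anticommute with `A`, so `E`, which anticommutes
  -- with `B` there, is `A`. But `E` commutes with `B` at `i`.
  have hEA := hC.eq_of_form_eq_one hA hB hD hE hABj (agree hA hB hD hABj hADj) hBD hBEj
  rw [hEA, hBA] at hBEi
  exact absurd hBEi one_ne_zero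

theorem orthogonal_le : (sympForm ι).orthogonal C.stab ≤ C.stab := by
  choose p hp0 hp1 q hq hpq using hC.exists_form_eq_one_iff
  have hinj : Function.Injective q := by
    intro i j hij
    by_contra hne
    -- With `q i = q j`, every generator anticommutes with both `p i` and `p j` or with neither, so
    -- none detects their product.
    obtain ⟨g, hg, h⟩ := hC.exists_gen_form_add_form hne (hp0 i) (add_le_add (hp1 i) (hp1 j))
    have hiff : form (p i) (g i) = 1 ↔ form (p j) (g j) = 1 := by
      rw [hpq i g hg, hpq j g hg, hij]
    have hcases : ∀ s t : ZMod 2, (s = 1 ↔ t = 1) → s + t ≠ 1 := by decide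
    exact hcases _ _ hiff h
  have hform : ∀ i j, form (p i) (q j i) = if j = i then 1 else 0 := by
    intro i j
    by_cases hij : j = i
    · rw [if_pos hij, hpq i _ (hq j), hij]
    · rw [if_neg hij]
      refine (ZMod.two_eq_zero_or_one _).resolve_right fun h => hij (hinj ?_)
      exact (hpq i _ (hq j)).mp h
  have hli : LinearIndependent (ZMod 2) q := by
    rw [Fintype.linearIndependent_iff]
    intro c hc i
    have h : sympForm ι (Pi.single i (p i)) (∑ j, c j • q j) = c i := by
      simp only [map_sum, map_smul, sympForm_single_left, hform]
      simp
    rw [← h, hc, map_zero]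
  have hcard : Fintype.card ι ≤ Module.finrank (ZMod 2) C.stab := by
    rw [← finrank_span_eq_card hli]
    refine Submodule.finrank_mono (Submodule.span_le.mpr ?_)
    rintro _ ⟨i, rfl⟩
    exact (hq i).1
  have hle : C.stab ≤ (sympForm ι).orthogonal C.stab := fun x hx =>
    mem_sympForm_orthogonal.mpr fun y hy => C.isotropic x hx y hy
  refine (Submodule.eq_of_le_of_finrank_le hle ?_).ge
  have := finrank_sympForm_orthogonal C.stab
  omega

end IsReduced

/-! ### Induction on the number of sites -/

theorem orthogonal_le_of_card_eq_one {ι : Type} [Fintype ι] (C : CostedCode ι)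
    (hι : Fintype.card ι = 1) : (sympForm ι).orthogonal C.stab ≤ C.stab := by
  classical
  obtain ⟨i, hi⟩ := Fintype.card_eq_one_iff.mp hι
  obtain ⟨a, ha, ha2⟩ := C.exists_cost_le_two i
  intro x hx
  rw [mem_sympForm_orthogonal] at hx
  have hsymp : ∀ y z : ι → PauliLabel, sympForm ι y z = form (y i) (z i) := fun y z =>
    Fintype.sum_eq_single i fun j hj => absurd (hi j) hj
  have hext : ∀ {y z : ι → PauliLabel}, y i = z i → y = z := fun h =>
    funext fun j => by rw [hi j, h]
  -- If there were no nonzero stabilizer, the cheap label at the only site would be logical, hence a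
  -- stabilizer.
  obtain ⟨s, hs, hs0⟩ : ∃ s ∈ C.stab, s ≠ 0 := by
    by_contra! hno
    have h := C.mem_stab_of_cost_le_two (Pi.single i a)
      (mem_sympForm_orthogonal.mpr fun y hy => by rw [hno y hy, map_zero])
      ((C.weight_single i a).trans_le ha2)
    have h' := congrFun (hno _ h) i
    rw [Pi.single_eq_same] at h'
    exact ha h'
  have hsi : s i ≠ 0 := fun h => hs0 (hext h)
  by_cases hxi : x i = 0
  · rw [show x = 0 from hext hxi]
    exact C.stab.zero_mem
  by_cases hxs : x i = s i
  · rwa [show x = s from hext hxs]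
  · have h := hx s hs
    rw [hsymp, PauliLabel.form_eq_one_of_ne hxi hsi hxs] at h
    exact absurd h one_ne_zero

/-- A costed code has no logical qubits. -/
theorem orthogonal_le {ι : Type} [Fintype ι] (C : CostedCode ι) :
    (sympForm ι).orthogonal C.stab ≤ C.stab := by
  classical
  obtain ⟨m, hm⟩ : ∃ m, Fintype.card ι = m := ⟨_, rfl⟩
  induction m using Nat.strong_induction_on generalizing ι with
  | _ m ih =>
    subst hm
    rcases Nat.lt_trichotomy (Fintype.card ι) 1 with h0 | h1 | h2
    · have : IsEmpty ι := Fintype.card_eq_zero_iff.mp (by omega)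
      intro x _
      rw [Subsingleton.elim x 0]
      exact C.stab.zero_mem
    · exact C.orthogonal_le_of_card_eq_one h1
    · have : Nontrivial ι := Fintype.one_lt_card_iff_nontrivial.mp h2
      by_cases hC : C.IsReduced
      · exact hC.orthogonal_le
      · unfold IsReduced at hC
        push Not at hC
        obtain ⟨M, T, hTS, hT, hcard, hM, v, hv, hvT, hv2, hvnot⟩ := hC
        obtain ⟨C', hC'⟩ := C.exists_merged hTS hT hcard hv hvT hv2 hvnot
        refine hC' (ih _ ?_ C' rfl)
        have h3 : Fintype.card (Option {i // i ∉ M}) = Fintype.card ι - M.card + 1 := by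
          rw [Fintype.card_option, Fintype.card_subtype_compl]
          simp
        rw [h3]
        have := M.card_le_univ
        omega

end CostedCode

/-! ### From Pauli operators to labels -/

namespace PauliGroup

variable {n : ℕ}

/-- The single-site labels of a Pauli operator, which determine it up to phase. -/
def labels (P : PauliGroup n) : Fin n → PauliLabel := fun i => (P.x i, P.z i)

theorem labels_mul (P Q : PauliGroup n) : labels (P * Q) = labels P + labels Q := rfl

theorem labels_one : labels (1 : PauliGroup n) = 0 := rfl

theorem labels_inv (P : PauliGroup n) : labels P⁻¹ = labels P := rfl

theorem signPhase_injective : Function.Injective signPhase := by decide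

theorem mul_comm_iff (P Q : PauliGroup n) :
    P * Q = Q * P ↔ sympForm (Fin n) (labels P) (labels Q) = 0 := by
  have h : sympForm (Fin n) (labels P) (labels Q) = P.z ⬝ᵥ Q.x + Q.z ⬝ᵥ P.x := by
    simp only [sympForm_apply, form, labels, dotProduct, ← Finset.sum_add_distrib]
    exact Finset.sum_congr rfl fun i _ => by ring
  rw [h, CharTwo.add_eq_zero, ← signPhase_injective.eq_iff, mul_def, mul_def, PauliGroup.mk.injEq,
    add_comm P.x, add_comm P.z, add_comm P.phase]
  simp

theorem weight_eq_sum (P : PauliGroup n) :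
    P.weight = ∑ i, if labels P i = 0 then 0 else 1 := by
  rw [weight, support, Finset.card_filter]
  refine Finset.sum_congr rfl fun i _ => ?_
  by_cases h : labels P i = 0
  · have h' : P.x i = 0 ∧ P.z i = 0 := Prod.mk_eq_zero.mp h
    simp [h, h'.1, h'.2]
  · have h' : ¬(P.x i = 0 ∧ P.z i = 0) := fun h' => h (Prod.mk_eq_zero.mpr h')
    rw [if_neg h, if_pos (by tauto)]

/-- The labels of the elements of a subgroup of the Pauli group. -/
def labelSpace (H : Subgroup (PauliGroup n)) : Submodule (ZMod 2) (Fin n → PauliLabel) where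
  carrier := labels '' (H : Set (PauliGroup n))
  zero_mem' := ⟨1, H.one_mem, rfl⟩
  add_mem' := by
    rintro _ _ ⟨P, hP, rfl⟩ ⟨Q, hQ, rfl⟩
    exact ⟨P * Q, H.mul_mem hP hQ, rfl⟩
  smul_mem' := by
    rintro c _ ⟨P, hP, rfl⟩
    rcases ZMod.two_eq_zero_or_one c with rfl | rfl
    · exact ⟨1, H.one_mem, by rw [zero_smul, labels_one]⟩
    · exact ⟨P, hP, by rw [one_smul]⟩

theorem labels_mem_labelSpace {H : Subgroup (PauliGroup n)} {P : PauliGroup n} (hP : P ∈ H) :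
    labels P ∈ labelSpace H := ⟨P, hP, rfl⟩

theorem labelSpace_closure (s : Set (PauliGroup n)) :
    labelSpace (Subgroup.closure s) = Submodule.span (ZMod 2) (labels '' s) := by
  apply le_antisymm
  · rintro _ ⟨P, hP, rfl⟩
    induction hP using Subgroup.closure_induction with
    | mem P hP => exact Submodule.subset_span ⟨P, hP, rfl⟩
    | one => exact Submodule.zero_mem _
    | mul P Q _ _ hP hQ => exact Submodule.add_mem _ hP hQ
    | inv P _ hP => exact hP
  · rw [Submodule.span_le]
    rintro _ ⟨P, hP, rfl⟩
    exact labels_mem_labelSpace (Subgroup.subset_closure hP)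

/-- Two elements with equal labels differ by a scalar in `H`. This scalar is not `-I`, and not `±
i`, whose square is `-I`. -/
theorem labels_injOn {H : Subgroup (PauliGroup n)} (hH : negI ∉ H) :
    Set.InjOn labels (H : Set (PauliGroup n)) := by
  intro P hP Q hQ h
  have hmem : P * Q⁻¹ ∈ H := H.mul_mem hP (H.inv_mem hQ)
  have h0 : labels (P * Q⁻¹) = 0 := by
    rw [labels_mul, labels_inv, h]
    exact funext fun i => CharTwo.add_self_eq_zero _
  obtain ⟨c, hc⟩ : ∃ c, P * Q⁻¹ = scalar c :=
    ⟨(P * Q⁻¹).phase, PauliGroup.ext rfl (funext fun i => congrArg Prod.fst (congrFun h0 i))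
      (funext fun i => congrArg Prod.snd (congrFun h0 i))⟩
  rw [hc] at hmem
  have hsq : scalar c * scalar c = (scalar (c + c) : PauliGroup n) := by
    simp [mul_def, scalar, signPhase_zero]
  have hcases : ∀ c : ZMod 4, c = 0 ∨ c = 2 ∨ c + c = 2 := by decide
  rcases hcases c with rfl | rfl | h2
  · exact mul_inv_eq_one.mp hc
  · exact absurd hmem hH
  · have := H.mul_mem hmem hmem
    rw [hsq, h2] at this
    exact absurd this hH

/-- Since labels are injective on `H`, a basis of the label space lifts to a generating set;
conversely the labels of a generating set span. -/
theorem rank_eq_finrank_labelSpace {H : Subgroup (PauliGroup n)} (hH : negI ∉ H) :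
    Group.rank H = Module.finrank (ZMod 2) (labelSpace H) := by
  classical
  apply le_antisymm
  · let b := Module.finBasis (ZMod 2) (labelSpace H)
    choose P hP hPb using fun j => (b j).2
    have hclosure : Subgroup.closure ((Finset.univ.image P : Finset (PauliGroup n)) :
        Set (PauliGroup n)) = H := by
      have hle : Subgroup.closure ((Finset.univ.image P : Finset (PauliGroup n)) :
          Set (PauliGroup n)) ≤ H := by
        rw [Subgroup.closure_le, Finset.coe_image]
        rintro _ ⟨j, -, rfl⟩
        exact hP j
      refine le_antisymm hle fun Q hQ => ?_
      have hspan : labels Q ∈ Submodule.span (ZMod 2) (Set.range fun j => (b j : Fin n → _)) := by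
        have h := b.mem_span ⟨labels Q, labels_mem_labelSpace hQ⟩
        have h' := Submodule.mem_map_of_mem (f := (labelSpace H).subtype) h
        rw [Submodule.map_span, ← Set.range_comp] at h'
        exact h'
      have himage : labels '' ((Finset.univ.image P : Finset (PauliGroup n)) :
          Set (PauliGroup n)) = Set.range fun j => (b j : Fin n → PauliLabel) := by
        rw [Finset.coe_image, Finset.coe_univ, Set.image_univ, ← Set.range_comp]
        exact congrArg Set.range (funext hPb)
      rw [← himage, ← labelSpace_closure] at hspan
      obtain ⟨R, hR, hRQ⟩ := hspan
      rwa [← labels_injOn hH (hle hR) hQ hRQ]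
    calc Group.rank H = Group.rank (Subgroup.closure
          ((Finset.univ.image P : Finset (PauliGroup n)) : Set (PauliGroup n))) :=
          (Subgroup.rank_congr hclosure).symm
      _ ≤ (Finset.univ.image P).card := Subgroup.rank_closure_finset_le_card _
      _ ≤ Module.finrank (ZMod 2) (labelSpace H) :=
          Finset.card_image_le.trans (by rw [Finset.card_univ, Fintype.card_fin])
  · obtain ⟨s, hs, hsH⟩ := Group.rank_spec H
    have h : Subgroup.closure ((s.image H.subtype : Finset (PauliGroup n)) :
        Set (PauliGroup n)) = H := by
      rw [Finset.coe_image, ← MonoidHom.map_closure, hsH, ← MonoidHom.range_eq_map,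
        Subgroup.range_subtype]
    rw [← hs]
    calc Module.finrank (ZMod 2) (labelSpace H)
        = Module.finrank (ZMod 2) (Submodule.span (ZMod 2)
            (((s.image H.subtype).image labels : Finset (Fin n → PauliLabel)) :
              Set (Fin n → PauliLabel))) := by
          rw [Finset.coe_image, ← labelSpace_closure, h]
      _ ≤ ((s.image H.subtype).image labels).card := finrank_span_finset_le_card _
      _ ≤ s.card := Finset.card_image_le.trans Finset.card_image_le

end PauliGroup

/-! ### Stabilizer codes of distance greater than 2 -/

namespace StabilizerCode

open PauliGroup (labels labelSpace)

variable {n : ℕ} (C : StabilizerCode n)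

theorem sympForm_labelSpace : ∀ x ∈ labelSpace C.stabilizer, ∀ y ∈ labelSpace C.stabilizer,
    sympForm (Fin n) x y = 0 := by
  rintro _ ⟨P, hP, rfl⟩ _ ⟨Q, hQ, rfl⟩
  exact (PauliGroup.mul_comm_iff P Q).mp (C.commutes P hP Q hQ)

theorem mem_labelSpace_of_weight_le_two (hd : ¬C.distance ≤ 2) {x : Fin n → PauliLabel}
    (hx : x ∈ (sympForm (Fin n)).orthogonal (labelSpace C.stabilizer))
    (hx2 : ∑ i, (if x i = 0 then 0 else 1) ≤ 2) : x ∈ labelSpace C.stabilizer := by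
  by_contra hnot
  let P : PauliGroup n := ⟨0, fun i => (x i).1, fun i => (x i).2⟩
  have hP : labels P = x := rfl
  rw [mem_sympForm_orthogonal] at hx
  have hlog : C.IsNontrivialLogical P := by
    refine ⟨fun S hS => ?_, fun c hc => hnot ?_⟩
    · rw [PauliGroup.mul_comm_iff, hP]
      exact hx _ (PauliGroup.labels_mem_labelSpace hS)
    · have h := PauliGroup.labels_mem_labelSpace hc
      rwa [PauliGroup.labels_mul, hP, show labels (PauliGroup.scalar c : PauliGroup n) = 0 from rfl,
        zero_add] at h
  refine hd ((iInf₂_le P hlog).trans ?_)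
  rw [PauliGroup.weight_eq_sum, hP]
  exact_mod_cast hx2

/-- The costed code of a stabilizer code with check weight `3` and distance greater than `2`. -/
def toCostedCode (hw : C.HasCheckWeight 3) (hd : ¬C.distance ≤ 2) : CostedCode (Fin n) where
  cost _ a := if a = 0 then 0 else 1
  cost_zero _ := if_pos rfl
  cost_pos _ a ha := by rw [if_neg ha]
  cost_add _ a b := by
    revert a b; decide
  exists_cost_le_two _ := ⟨(1, 0), by decide, by decide⟩
  stab := labelSpace C.stabilizer
  isotropic := C.sympForm_labelSpace
  stab_le_span := by
    rw [stabilizer, PauliGroup.labelSpace_closure, Submodule.span_le]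
    rintro _ ⟨_, ⟨i, rfl⟩, rfl⟩
    refine Submodule.subset_span ⟨Submodule.subset_span ⟨_, ⟨i, rfl⟩, rfl⟩, ?_⟩
    rw [← PauliGroup.weight_eq_sum]
    exact hw i
  mem_stab_of_cost_le_two _ hx hx2 := C.mem_labelSpace_of_weight_le_two hd hx hx2

end StabilizerCode

/-- A stabilizer code with check weight 3 has distance at most 2 or dimension 0. -/
theorem theorem2 (n : ℕ) (C : StabilizerCode n) (hw : C.HasCheckWeight 3) :
    C.distance ≤ 2 ∨ C.dimension = 0 := by
  refine or_iff_not_imp_left.mpr fun hd => ?_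
  have hle : (sympForm (Fin n)).orthogonal (PauliGroup.labelSpace C.stabilizer) ≤
      PauliGroup.labelSpace C.stabilizer := (C.toCostedCode hw hd).orthogonal_le
  have hge : PauliGroup.labelSpace C.stabilizer ≤
      (sympForm (Fin n)).orthogonal (PauliGroup.labelSpace C.stabilizer) := fun x hx =>
    mem_sympForm_orthogonal.mpr fun y hy => C.sympForm_labelSpace x hx y hy
  have h := finrank_sympForm_orthogonal (PauliGroup.labelSpace C.stabilizer)
  rw [le_antisymm hle hge, Fintype.card_fin] at h
  have hrank := PauliGroup.rank_eq_finrank_labelSpace (H := C.stabilizer) C.negI_notMem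
  rw [StabilizerCode.dimension, hrank]
  omega
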